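/- Let $H$ be a complex Hilbert space, $A\subseteq B(H)$ a unital $C^*$-algebra (with $1_A=1_H$), $G$ a discrete group and $\alpha:G\to\mathrm{Aut}(A)$ a homomorphism into the group of $*$-automorphisms of $A$. On $\ell^2(G,H)$ put $(\pi(a)\xi)(s)=\alpha_{s^{-1}}(a)\xi(s)$ and $(\lambda_r\xi)(s)=\xi(r^{-1}s)$, for $f\in\ell^1(G,A)$ put $\pi\rtimes\lambda(f)=\sum_{s\in G}\pi(f(s))\lambda_s$, and let the reduced crossed product $A\rtimes_{\alpha,r}G$ be the norm closure of $\pi\rtimes\lambda(\ell^1(G,A))$ in $B(\ell^2(G,H))$. Below, $\ell^2=\ell^2(\mathbb N)$, $\otimes$ between $C^*$-algebras is the minimal tensor product, $CB(C)$ is the space of completely bounded linear maps on a $C^*$-algebra $C$, and for $T\in CB(C)$, or for $T$ a bounded linear map of finite rank on $C$, $T\otimes\mathrm{id}$ is the bounded map on $C\otimes B(\ell^2)$ with $(T\otimes\mathrm{id})(c\otimes b)=T(c)\otimes b$. A function $F:G\to CB(A)$ which is bounded in the cb-norm is a Herz–Schur $(A,G,\alpha)$-multiplier if the map $\pi\rtimes\lambda(f)\mapsto\pi\rtimes\lambda(F\cdot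 f)$, where $(F\cdot f)(r)=F(r)(f(r))$ for $f\in\ell^1(G,A)$, extends to a completely bounded map $S_F$ on $A\rtimes_{\alpha,r}G$. Let $Q(A,G,\alpha)$ be the set of all functionals $\omega_{x,\psi}$ on $CB(A\rtimes_{\alpha,r}G)$, $\omega_{x,\psi}(T)=\psi\big((T\otimes\mathrm{id})x\big)$, with $x\in(A\rtimes_{\alpha,r}G)\otimes B(\ell^2)$ and $\psi\in\big((A\rtimes_{\alpha,r}G)\otimes B(\ell^2)\big)^*$. The system $(A,G,\alpha)$ has the approximation property (AP) if there is a net $(F_i)_i$ of Herz–Schur $(A,G,\alpha)$-multipliers such that each $F_i$ is finitely supported, each $F_i(r)$ ($r\in G$) is a finite rank map on $A$, and $\omega(S_{F_i})\to\omega(\mathrm{id})$ for all $\omega\in Q(A,G,\alpha)$. A $C^*$-algebra $C$ has the strong operator approximation property (SOAP) if there is a net $(\Phi_i)_i$ of finite rank bounded linear maps on $C$ such that $\|(\Phi_i\otimes\mathrm{id})(x)-x\|\to0$ for every $x\in C\otimes B(\ell^2)$. **Theorem.** The system $(A,G,\alpha)$ has the AP if and only if $A\rtimes_{\alpha,r}G$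 has the SOAP. -/

import Mathlib

set_option linter.unusedSectionVars false

open scoped TensorProduct

open Filter Topology

universe u v

noncomputable section

namespace CrossedProductAP

/-! ### Matrix norms and completely bounded maps -/

section CompletelyBounded

variable {K : Type*} [NormedAddCommGroup K] [InnerProductSpace ℂ K]

/-- The bounded operator on the Hilbert space `K ⊕ ⋯ ⊕ K` (`n` copies) given by an `n × n` matrix
of bounded operators on `K`. Its operator norm is the norm of the matrix in `Mₙ(B(K)) = B(Kⁿ)`. -/
def blockOperator {n : ℕ} (x : Matrix (Fin n) (Fin n) (K →L[ℂ] K)) :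
    PiLp 2 (fun _ : Fin n => K) →L[ℂ] PiLp 2 (fun _ : Fin n => K) :=
  (PiLp.continuousLinearEquiv 2 ℂ (fun _ : Fin n => K)).symm.toContinuousLinearMap ∘L
    ContinuousLinearMap.pi (fun i => ∑ j, x i j ∘L PiLp.proj 2 (fun _ : Fin n => K) j)

lemma blockOperator_apply {n : ℕ} (x : Matrix (Fin n) (Fin n) (K →L[ℂ] K))
    (ξ : PiLp 2 (fun _ : Fin n => K)) (i : Fin n) :
    blockOperator x ξ i = ∑ j, x i j (ξ j) := by
  simp [blockOperator]

lemma blockOperator_add {n : ℕ} (x y : Matrix (Fin n) (Fin n) (K →L[ℂ] K)) :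
    blockOperator (x + y) = blockOperator x + blockOperator y := by
  ext ξ i
  simp [blockOperator_apply, Finset.sum_add_distrib]

lemma blockOperator_smul {n : ℕ} (a : ℂ) (x : Matrix (Fin n) (Fin n) (K →L[ℂ] K)) :
    blockOperator (a • x) = a • blockOperator x := by
  ext ξ i
  simp [blockOperator_apply, Finset.smul_sum]

variable [CompleteSpace K] {C : StarSubalgebra ℂ (K →L[ℂ] K)}

/-- `‖T‖_cb ≤ M` for a map `T` on a concrete C*-algebra `C ⊆ B(K)`: every amplification
`[c_{ij}] ↦ [T c_{ij}]` on `Mₙ(C)` is bounded by `M`. -/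
def CBBound (T : C →L[ℂ] C) (M : ℝ) : Prop :=
  ∀ (n : ℕ) (x : Matrix (Fin n) (Fin n) C),
    ‖blockOperator (x.map fun c => (T c : K →L[ℂ] K))‖ ≤
      M * ‖blockOperator (x.map fun c => (c : K →L[ℂ] K))‖

lemma CBBound.mono {T : C →L[ℂ] C} {M N : ℝ} (h : CBBound T M) (hMN : M ≤ N) : CBBound T N :=
  fun n x => (h n x).trans (by gcongr)

variable (C) in
/-- The space `CB(C)` of completely bounded linear maps on a concrete C*-algebra `C ⊆ B(K)`. -/
def CBMap : Submodule ℂ (C →L[ℂ] C) where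
  carrier := {T | ∃ M : ℝ, CBBound T M}
  add_mem' := by
    rintro S T ⟨M, hM⟩ ⟨N, hN⟩
    refine ⟨M + N, fun n x => ?_⟩
    have h : (x.map fun c => ((S + T) c : K →L[ℂ] K)) =
        (x.map fun c => (S c : K →L[ℂ] K)) + (x.map fun c => (T c : K →L[ℂ] K)) := by
      ext; simp
    rw [h, blockOperator_add, add_mul]
    exact (norm_add_le _ _).trans (add_le_add (hM n x) (hN n x))
  zero_mem' := by
    refine ⟨0, fun n x => ?_⟩
    have h : blockOperator (x.map fun c => ((0 : C →L[ℂ] C) c : K →L[ℂ] K)) = 0 := by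
      ext ξ i
      simp [blockOperator_apply]
    rw [h, norm_zero, zero_mul]
  smul_mem' := by
    rintro a T ⟨M, hM⟩
    refine ⟨‖a‖ * M, fun n x => ?_⟩
    have h : (x.map fun c => ((a • T) c : K →L[ℂ] K)) =
        a • (x.map fun c => (T c : K →L[ℂ] K)) := by
      ext; simp
    rw [h, blockOperator_smul, norm_smul, mul_assoc]
    gcongr
    exact hM n x

variable (C) in
/-- The identity map of `C`, as a completely bounded map. -/
def CBMap.id : CBMap C := ⟨ContinuousLinearMap.id ℂ C, 1, fun n x => by simp⟩

end CompletelyBounded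

/-! ### The minimal tensor product with `B(ℓ²)` and the maps `T ⊗ id` -/

section Tensor

/-- The Hilbert space `ℓ² = ℓ²(ℕ)`. -/
abbrev ell2 : Type := lp (fun _ : ℕ => ℂ) 2

variable (K : Type*) [NormedAddCommGroup K] [InnerProductSpace ℂ K]

/-- The Hilbert space tensor product `K ⊗ ℓ²`. -/
def HilbertTensor : Type _ := UniformSpace.Completion (K ⊗[ℂ] ell2)

instance : NormedAddCommGroup (HilbertTensor K) :=
  inferInstanceAs (NormedAddCommGroup (UniformSpace.Completion (K ⊗[ℂ] ell2)))

instance : InnerProductSpace ℂ (HilbertTensor K) :=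
  inferInstanceAs (InnerProductSpace ℂ (UniformSpace.Completion (K ⊗[ℂ] ell2)))

instance : CompleteSpace (HilbertTensor K) :=
  inferInstanceAs (CompleteSpace (UniformSpace.Completion (K ⊗[ℂ] ell2)))

/-- The inclusion of the algebraic tensor product `K ⊙ ℓ²` in `K ⊗ ℓ²`. -/
def HilbertTensor.incl : K ⊗[ℂ] ell2 →ₗᵢ[ℂ] HilbertTensor K :=
  UniformSpace.Completion.toComplₗᵢ

lemma HilbertTensor.denseRange_incl : DenseRange (HilbertTensor.incl K) :=
  UniformSpace.Completion.denseRange_coe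

variable {K}

/-- The operator `c ⊗ b` on `K ⊗ ℓ²`. -/
def opTensor (c : K →L[ℂ] K) (b : ell2 →L[ℂ] ell2) : HilbertTensor K →L[ℂ] HilbertTensor K :=
  (TensorProduct.mapL c b).completion

lemma opTensor_incl (c : K →L[ℂ] K) (b : ell2 →L[ℂ] ell2) (v : K ⊗[ℂ] ell2) :
    opTensor c b (HilbertTensor.incl K v) =
      HilbertTensor.incl K (TensorProduct.mapL c b v : K ⊗[ℂ] ell2) :=
  ContinuousLinearMap.completion_apply_coe (TensorProduct.mapL c b) v

lemma hilbertTensor_ext {S T : HilbertTensor K →L[ℂ] HilbertTensor K}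
    (h : ∀ v : K ⊗[ℂ] ell2, S (HilbertTensor.incl K v) = T (HilbertTensor.incl K v)) : S = T :=
  ContinuousLinearMap.coeFn_injective <|
    (HilbertTensor.denseRange_incl K).equalizer S.continuous T.continuous (funext h)

/-- `(c, b) ↦ c ⊗ b` as a bilinear map. -/
def opTensorBilin : (K →L[ℂ] K) →ₗ[ℂ] (ell2 →L[ℂ] ell2) →ₗ[ℂ]
    (HilbertTensor K →L[ℂ] HilbertTensor K) :=
  LinearMap.mk₂ ℂ opTensor
    (fun c c' b => hilbertTensor_ext fun v => by
      simp [opTensor_incl, TensorProduct.mapL_add_left])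
    (fun a c b => hilbertTensor_ext fun v => by
      simp [opTensor_incl, TensorProduct.mapL_smul_left])
    (fun c b b' => hilbertTensor_ext fun v => by
      simp [opTensor_incl, TensorProduct.mapL_add_right])
    (fun a c b => hilbertTensor_ext fun v => by
      simp [opTensor_incl, TensorProduct.mapL_smul_right])

variable [CompleteSpace K] (C : StarSubalgebra ℂ (K →L[ℂ] K))

/-- The canonical map of the algebraic tensor product `C ⊙ B(ℓ²)` into `B(K ⊗ ℓ²)`. -/
def algTensorMap : C ⊗[ℂ] (ell2 →L[ℂ] ell2) →ₗ[ℂ] (HilbertTensor K →L[ℂ] HilbertTensor K) :=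
  TensorProduct.lift (opTensorBilin ∘ₗ C.toSubalgebra.val.toLinearMap)

variable {C} in
lemma algTensorMap_tmul (c : C) (b : ell2 →L[ℂ] ell2) :
    algTensorMap C (c ⊗ₜ b) = opTensor (c : K →L[ℂ] K) b := rfl

/-- The minimal C*-tensor product `C ⊗ B(ℓ²)` of a concrete C*-algebra `C ⊆ B(K)`: the norm
closure of the algebraic tensor product in `B(K ⊗ ℓ²)`, as a normed space. -/
def minTensor : Submodule ℂ (HilbertTensor K →L[ℂ] HilbertTensor K) :=
  (LinearMap.range (algTensorMap C)).topologicalClosure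

instance : CompleteSpace (minTensor C) :=
  (Submodule.isClosed_topologicalClosure _).completeSpace_coe

/-- The canonical map of the algebraic tensor product `C ⊙ B(ℓ²)` into `C ⊗ B(ℓ²)`. -/
def toMinTensor : C ⊗[ℂ] (ell2 →L[ℂ] ell2) →ₗ[ℂ] minTensor C :=
  (algTensorMap C).codRestrict _ fun u => Submodule.le_topologicalClosure _ ⟨u, rfl⟩

lemma denseRange_toMinTensor : DenseRange (toMinTensor C) := by
  intro y
  rw [Metric.mem_closure_iff]
  intro ε hε
  have hy : (y : HilbertTensor K →L[ℂ] HilbertTensor K) ∈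
      closure (LinearMap.range (algTensorMap C) : Set _) := y.2
  obtain ⟨_, ⟨u, rfl⟩, hu⟩ := Metric.mem_closure_iff.1 hy ε hε
  exact ⟨_, ⟨u, rfl⟩, hu⟩

variable {C}

/-- The bounded map `T ⊗ id` on `C ⊗ B(ℓ²)`: the continuous extension of the map determined by
`c ⊗ b ↦ T c ⊗ b` on the algebraic tensor product. The extension exists for every completely
bounded `T` (see `amplify_toMinTensor`), in particular for every bounded `T` of finite rank. -/
def amplify (T : C →L[ℂ] C) : minTensor C →L[ℂ] minTensor C :=
  (toMinTensor C ∘ₗ TensorProduct.map T.toLinearMap LinearMap.id).extendOfNorm (toMinTensor C)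


/-- The standard basis of `ℓ²`. -/
def basisVec (i : ℕ) : ell2 := lp.single 2 i (1 : ℂ)

lemma inner_basisVec (i : ℕ) (v : ell2) : inner ℂ (basisVec i) v = v i := by
  simp [basisVec, lp.inner_single_left]

/-- The inclusion `(ξ₀, …, ξₙ₋₁) ↦ ∑ ξⱼ ⊗ eⱼ` of `Kⁿ` in `K ⊗ ℓ²`. -/
def colIncl (n : ℕ) (ξ : PiLp 2 (fun _ : Fin n => K)) : HilbertTensor K :=
  HilbertTensor.incl K (∑ j : Fin n, ξ j ⊗ₜ[ℂ] basisVec j)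

lemma inner_colIncl (n : ℕ) (ξ η : PiLp 2 (fun _ : Fin n => K)) :
    inner ℂ (colIncl n η) (colIncl n ξ) = inner ℂ η ξ := by
  rw [colIncl, colIncl, LinearIsometry.inner_map_map, PiLp.inner_apply, sum_inner]
  refine Finset.sum_congr rfl fun i _ => ?_
  rw [inner_sum, Finset.sum_eq_single i]
  · simp [TensorProduct.inner_tmul, basisVec]
  · intro j _ hj
    have hij : (i : ℕ) ≠ j := fun h => hj (Fin.ext h.symm)
    rw [TensorProduct.inner_tmul, inner_basisVec]
    simp [basisVec, hij]
  · simp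

lemma norm_colIncl (n : ℕ) (ξ : PiLp 2 (fun _ : Fin n => K)) : ‖colIncl n ξ‖ = ‖ξ‖ := by
  have h := inner_colIncl n ξ ξ
  rw [inner_self_eq_norm_sq_to_K, inner_self_eq_norm_sq_to_K] at h
  have h' : ‖colIncl n ξ‖ ^ 2 = ‖ξ‖ ^ 2 := by exact_mod_cast h
  exact (sq_eq_sq₀ (norm_nonneg _) (norm_nonneg _)).1 h'

/-- The slice map `c ⊗ b ↦ ⟨eᵢ, b eⱼ⟩ c` on the algebraic tensor product. -/
def slice (C : StarSubalgebra ℂ (K →L[ℂ] K)) (i j : ℕ) : C ⊗[ℂ] (ell2 →L[ℂ] ell2) →ₗ[ℂ] C :=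
  TensorProduct.lift <| LinearMap.mk₂ ℂ (fun c b => (b (basisVec j) i) • c)
    (fun c c' b => by simp) (fun a c b => by simp [smul_comm a])
    (fun c b b' => by simp [add_smul]) (fun a c b => by simp [mul_smul])

lemma slice_tmul (i j : ℕ) (c : C) (b : ell2 →L[ℂ] ell2) :
    slice C i j (c ⊗ₜ b) = (b (basisVec j) i) • c := rfl

lemma slice_map (T : C →L[ℂ] C) (i j : ℕ) (u : C ⊗[ℂ] (ell2 →L[ℂ] ell2)) :
    slice C i j (TensorProduct.map T.toLinearMap LinearMap.id u) = T (slice C i j u) := by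
  induction u with
  | zero => simp
  | add u v hu hv => simp only [map_add, hu, hv]
  | tmul c b => simp [slice_tmul]

/-- The `n × n` corner of the matrix of an element of the algebraic tensor product. -/
def corner (n : ℕ) (u : C ⊗[ℂ] (ell2 →L[ℂ] ell2)) : Matrix (Fin n) (Fin n) C :=
  Matrix.of fun i j => slice C i j u

lemma inner_corner (n : ℕ) (u : C ⊗[ℂ] (ell2 →L[ℂ] ell2)) (ξ η : PiLp 2 (fun _ : Fin n => K)) :
    inner ℂ (colIncl n η) (algTensorMap C u (colIncl n ξ)) =
      inner ℂ η (blockOperator ((corner n u).map fun c => (c : K →L[ℂ] K)) ξ) := by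
  simp only [PiLp.inner_apply, blockOperator_apply, corner, Matrix.map_apply, Matrix.of_apply]
  induction u with
  | zero => simp
  | add u v hu hv =>
    simp only [map_add, add_apply, inner_add_right, hu, hv, AddMemClass.coe_add,
      Finset.sum_add_distrib]
  | tmul c b =>
    rw [algTensorMap_tmul, colIncl, colIncl, opTensor_incl, LinearIsometry.inner_map_map, sum_inner]
    refine Finset.sum_congr rfl fun i _ => ?_
    simp [slice_tmul, TensorProduct.inner_tmul, inner_basisVec, inner_sum, inner_smul_right,
      mul_comm]

lemma norm_corner_le (n : ℕ) (u : C ⊗[ℂ] (ell2 →L[ℂ] ell2)) :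
    ‖blockOperator ((corner n u).map fun c => (c : K →L[ℂ] K))‖ ≤ ‖algTensorMap C u‖ := by
  refine ContinuousLinearMap.opNorm_le_bound _ (norm_nonneg _) fun ξ => ?_
  set η := blockOperator ((corner n u).map fun c => (c : K →L[ℂ] K)) ξ with hη
  have h : ‖η‖ ^ 2 ≤ ‖η‖ * (‖algTensorMap C u‖ * ‖ξ‖) := by
    have h1 : ((‖η‖ ^ 2 : ℝ) : ℂ) = inner ℂ (colIncl n η) (algTensorMap C u (colIncl n ξ)) := by
      rw [inner_corner, ← hη, inner_self_eq_norm_sq_to_K]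
      norm_cast
    calc ‖η‖ ^ 2 = ‖((‖η‖ ^ 2 : ℝ) : ℂ)‖ := by simp
      _ ≤ ‖colIncl n η‖ * ‖algTensorMap C u (colIncl n ξ)‖ := by
        rw [h1]; exact norm_inner_le_norm _ _
      _ ≤ ‖η‖ * (‖algTensorMap C u‖ * ‖ξ‖) := by
        rw [norm_colIncl]
        gcongr
        exact (ContinuousLinearMap.le_opNorm _ _).trans_eq (by rw [norm_colIncl])
  rcases (norm_nonneg η).eq_or_lt with h0 | h0
  · rw [← h0]; positivity
  · rw [sq] at h
    exact le_of_mul_le_mul_left h h0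

lemma colIncl_add (n : ℕ) (ξ η : PiLp 2 (fun _ : Fin n => K)) :
    colIncl n (ξ + η) = colIncl n ξ + colIncl n η := by
  simp [colIncl, TensorProduct.add_tmul, Finset.sum_add_distrib]

lemma colIncl_smul (n : ℕ) (a : ℂ) (ξ : PiLp 2 (fun _ : Fin n => K)) :
    colIncl n (a • ξ) = a • colIncl n ξ := by
  simp only [colIncl, PiLp.smul_apply, ← TensorProduct.smul_tmul', ← Finset.smul_sum, map_smul]

variable (K) in
/-- The union of the subspaces `Kⁿ` of `K ⊗ ℓ²`. -/
def finiteColumns : Submodule ℂ (HilbertTensor K) where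
  carrier := {v | ∃ N, ∀ n, N ≤ n → ∃ ξ, colIncl n ξ = v}
  add_mem' := by
    rintro v w ⟨N₁, h₁⟩ ⟨N₂, h₂⟩
    refine ⟨max N₁ N₂, fun n hn => ?_⟩
    obtain ⟨ξ, rfl⟩ := h₁ n (le_of_max_le_left hn)
    obtain ⟨η, rfl⟩ := h₂ n (le_of_max_le_right hn)
    exact ⟨ξ + η, colIncl_add n ξ η⟩
  zero_mem' := ⟨0, fun n _ => ⟨0, by simp [colIncl]⟩⟩
  smul_mem' := by
    rintro a v ⟨N, h⟩
    refine ⟨N, fun n hn => ?_⟩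
    obtain ⟨ξ, rfl⟩ := h n hn
    exact ⟨a • ξ, colIncl_smul n a ξ⟩

lemma dense_finiteColumns : Dense (finiteColumns K : Set (HilbertTensor K)) := by
  have h1 : ∀ (k : K) (i : ℕ), HilbertTensor.incl K (k ⊗ₜ basisVec i) ∈ finiteColumns K := by
    refine fun k i => ⟨i + 1, fun n hn => ⟨PiLp.single 2 ⟨i, hn⟩ k, ?_⟩⟩
    rw [colIncl, Finset.sum_eq_single ⟨i, hn⟩]
    · simp
    · intro j _ hj
      simp [hj]
    · simp
  have h2 : ∀ (k : K) (v : ell2),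
      HilbertTensor.incl K (k ⊗ₜ v) ∈ (finiteColumns K).topologicalClosure := by
    intro k v
    have hs : HasSum (fun i => lp.single 2 i (v i)) v := lp.hasSum_single (by simp) v
    have hs' := ((HilbertTensor.incl K).toContinuousLinearMap ∘L
      TensorProduct.mkL ℂ K ell2 k).hasSum hs
    refine (Submodule.isClosed_topologicalClosure _).mem_of_tendsto hs'
      (Filter.Eventually.of_forall fun s => Submodule.sum_mem _ fun i _ => ?_)
    have hi : lp.single 2 i (v i) = v i • basisVec i := by
      rw [basisVec, ← lp.single_smul, smul_eq_mul, mul_one]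
    simp only [hi, map_smul]
    exact Submodule.smul_mem _ _ (Submodule.le_topologicalClosure _ (h1 k i))
  have h3 : ∀ u, HilbertTensor.incl K u ∈ (finiteColumns K).topologicalClosure := by
    intro u
    induction u with
    | zero => simp
    | add u v hu hv => rw [map_add]; exact Submodule.add_mem _ hu hv
    | tmul k v => exact h2 k v
  rw [dense_iff_closure_eq, ← Submodule.topologicalClosure_coe, Set.eq_univ_iff_forall]
  exact fun v => closure_minimal (Set.range_subset_iff.2 h3)
    (Submodule.isClosed_topologicalClosure _) (HilbertTensor.denseRange_incl K v)

lemma norm_algTensorMap_map_le (T : C →L[ℂ] C) {M : ℝ} (hM : CBBound T M)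
    (u : C ⊗[ℂ] (ell2 →L[ℂ] ell2)) :
    ‖algTensorMap C (TensorProduct.map T.toLinearMap LinearMap.id u)‖ ≤
      max M 0 * ‖algTensorMap C u‖ := by
  set R := algTensorMap C (TensorProduct.map T.toLinearMap LinearMap.id u) with hR
  have key : ∀ v w : HilbertTensor K,
      ‖inner ℂ w (R v)‖ ≤ max M 0 * ‖algTensorMap C u‖ * ‖v‖ * ‖w‖ := by
    let P : Set (HilbertTensor K × HilbertTensor K) :=
      {p | ‖inner ℂ p.2 (R p.1)‖ ≤ max M 0 * ‖algTensorMap C u‖ * ‖p.1‖ * ‖p.2‖}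
    have hc : IsClosed P := isClosed_le (by fun_prop) (by fun_prop)
    have hd := (dense_finiteColumns (K := K)).prod (dense_finiteColumns (K := K))
    suffices hs : (finiteColumns K : Set (HilbertTensor K)) ×ˢ
        (finiteColumns K : Set (HilbertTensor K)) ⊆ P by
      intro v w
      have hm : (v, w) ∈ P := closure_minimal hs hc (hd (v, w))
      exact hm
    · rintro ⟨v, w⟩ ⟨⟨N₁, h₁⟩, ⟨N₂, h₂⟩⟩
      obtain ⟨ξ, hξ⟩ := h₁ (max N₁ N₂) (le_max_left _ _)
      obtain ⟨η, hη⟩ := h₂ (max N₁ N₂) (le_max_right _ _)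
      generalize max N₁ N₂ = n at *
      have hcor : ((corner n (TensorProduct.map T.toLinearMap LinearMap.id u)).map
          fun c => (c : K →L[ℂ] K)) = (corner n u).map fun c => (T c : K →L[ℂ] K) := by
        ext i j : 2
        simp only [corner, Matrix.map_apply, Matrix.of_apply, slice_map]
      change ‖inner ℂ w (R v)‖ ≤ max M 0 * ‖algTensorMap C u‖ * ‖v‖ * ‖w‖
      dsimp only at hξ hη
      rw [← hξ, ← hη, hR, inner_corner, norm_colIncl, norm_colIncl, hcor]
      have hb := (hM n (corner n u)).trans (mul_le_mul (le_max_left M 0) (norm_corner_le n u)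
        (norm_nonneg _) (le_max_right M 0))
      calc _ ≤ ‖η‖ * ‖blockOperator ((corner n u).map fun c => (T c : K →L[ℂ] K)) ξ‖ :=
            norm_inner_le_norm _ _
        _ ≤ ‖η‖ * (max M 0 * ‖algTensorMap C u‖ * ‖ξ‖) := by
            gcongr
            exact ContinuousLinearMap.le_of_opNorm_le _ hb _
        _ = _ := by ring
  refine ContinuousLinearMap.opNorm_le_bound _ (by positivity) fun v => ?_
  have h := key v (R v)
  rw [inner_self_eq_norm_sq_to_K] at h
  rcases (norm_nonneg (R v)).eq_or_lt with h0 | h0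
  · rw [← h0]; positivity
  · refine le_of_mul_le_mul_right ?_ h0
    simpa [sq] using h

/-- For completely bounded `T`, the map `T ⊗ id` does send `c ⊗ b` to `T c ⊗ b`. -/
theorem amplify_toMinTensor (T : CBMap C) (u : C ⊗[ℂ] (ell2 →L[ℂ] ell2)) :
    amplify (T : C →L[ℂ] C) (toMinTensor C u) =
      toMinTensor C (TensorProduct.map (T : C →L[ℂ] C).toLinearMap LinearMap.id u) := by
  obtain ⟨M, hM⟩ := T.2
  exact LinearMap.extendOfNorm_eq (denseRange_toMinTensor C)
    ⟨max M 0, fun u => norm_algTensorMap_map_le _ hM u⟩ u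

lemma norm_vecSlice_le (ξ η : ell2) (u : C ⊗[ℂ] (ell2 →L[ℂ] ell2)) :
    ∃ s : C, ‖s‖ ≤ ‖algTensorMap C u‖ * ‖ξ‖ * ‖η‖ ∧ ∀ φ : C →L[ℂ] ℂ,
      inner ℂ η (TensorProduct.lid ℂ _ (TensorProduct.map φ.toLinearMap LinearMap.id u) ξ) =
        φ s := by
  obtain ⟨s, h1, h2⟩ : ∃ s : C,
      (∀ k l : K, inner ℂ l ((s : K →L[ℂ] K) k) =
        inner ℂ (HilbertTensor.incl K (l ⊗ₜ η))
          (algTensorMap C u (HilbertTensor.incl K (k ⊗ₜ ξ)))) ∧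
      ∀ φ : C →L[ℂ] ℂ,
        inner ℂ η (TensorProduct.lid ℂ _ (TensorProduct.map φ.toLinearMap LinearMap.id u) ξ) =
          φ s := by
    induction u with
    | zero => exact ⟨0, by simp, by simp⟩
    | add u v hu hv =>
      obtain ⟨s, hs, hs'⟩ := hu
      obtain ⟨t, ht, ht'⟩ := hv
      refine ⟨s + t, fun k l => ?_, fun φ => ?_⟩
      · simp only [map_add, add_apply, inner_add_right, AddMemClass.coe_add, hs, ht]
      · simp only [map_add, add_apply, inner_add_right, hs', ht']
    | tmul c b =>
      refine ⟨inner ℂ η (b ξ) • c, fun k l => ?_, fun φ => ?_⟩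
      · rw [algTensorMap_tmul, opTensor_incl, LinearIsometry.inner_map_map]
        simp [TensorProduct.inner_tmul, mul_comm]
      · simp [mul_comm]
  refine ⟨s, ?_, h2⟩
  refine ContinuousLinearMap.opNorm_le_bound _ (by positivity) fun k => ?_
  set l := (s : K →L[ℂ] K) k with hl
  have hb : ‖l‖ * ‖l‖ ≤ (‖algTensorMap C u‖ * ‖ξ‖ * ‖η‖ * ‖k‖) * ‖l‖ := by
    have h3 := h1 k l
    rw [← hl, inner_self_eq_norm_sq_to_K] at h3
    have h4 : ‖l‖ * ‖l‖ = ‖inner ℂ (HilbertTensor.incl K (l ⊗ₜ η))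
          (algTensorMap C u (HilbertTensor.incl K (k ⊗ₜ ξ)))‖ := by
      rw [← h3]; simp [sq]
    rw [h4]
    refine (norm_inner_le_norm _ _).trans ?_
    rw [LinearIsometry.norm_map, TensorProduct.norm_tmul]
    calc _ ≤ ‖l‖ * ‖η‖ * (‖algTensorMap C u‖ * (‖k‖ * ‖ξ‖)) := by
          gcongr
          refine (ContinuousLinearMap.le_opNorm _ _).trans_eq ?_
          rw [LinearIsometry.norm_map, TensorProduct.norm_tmul]
      _ = _ := by ring
  change ‖l‖ ≤ _
  rcases (norm_nonneg l).eq_or_lt with h0 | h0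
  · rw [← h0]; positivity
  · exact le_of_mul_le_mul_right hb h0

lemma norm_opTensor_le (c : K →L[ℂ] K) (b : ell2 →L[ℂ] ell2) :
    ‖opTensor c b‖ ≤ ‖c‖ * ‖b‖ := by
  refine ContinuousLinearMap.opNorm_le_bound _ (by positivity) fun v => ?_
  refine (HilbertTensor.denseRange_incl K).induction_on (p := fun v =>
    ‖opTensor c b v‖ ≤ ‖c‖ * ‖b‖ * ‖v‖) v (isClosed_le (by fun_prop) (by fun_prop)) fun v => ?_
  rw [opTensor_incl, LinearIsometry.norm_map, LinearIsometry.norm_map]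
  exact ContinuousLinearMap.le_of_opNorm_le _ (TensorProduct.norm_mapL_le c b) v

/-- A bounded map of rank one is tensored with the identity without loss of norm. -/
lemma norm_algTensorMap_map_smulRight_le (φ : C →L[ℂ] ℂ) (c : C)
    (u : C ⊗[ℂ] (ell2 →L[ℂ] ell2)) :
    ‖algTensorMap C (TensorProduct.map (φ.smulRight c).toLinearMap LinearMap.id u)‖ ≤
      ‖φ‖ * ‖c‖ * ‖algTensorMap C u‖ := by
  set b := TensorProduct.lid ℂ _ (TensorProduct.map φ.toLinearMap LinearMap.id u) with hb
  have h1 : algTensorMap C (TensorProduct.map (φ.smulRight c).toLinearMap LinearMap.id u) =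
      opTensor (c : K →L[ℂ] K) b := by
    rw [hb, ← algTensorMap_tmul]
    congr 1
    clear hb b
    induction u with
    | zero => simp
    | add u v hu hv => simp only [map_add, hu, hv, TensorProduct.tmul_add]
    | tmul d b => simp [TensorProduct.smul_tmul]
  have h2 : ‖b‖ ≤ ‖φ‖ * ‖algTensorMap C u‖ := by
    refine ContinuousLinearMap.opNorm_le_bound _ (by positivity) fun ξ => ?_
    obtain ⟨s, hs, hs'⟩ := norm_vecSlice_le ξ (b ξ) u
    have h3 := hs' φ
    rw [← hb, inner_self_eq_norm_sq_to_K] at h3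
    have h4 : ‖b ξ‖ * ‖b ξ‖ ≤ ‖φ‖ * ‖algTensorMap C u‖ * ‖ξ‖ * ‖b ξ‖ := by
      have h5 : ‖b ξ‖ * ‖b ξ‖ = ‖φ s‖ := by rw [← h3]; simp [sq]
      rw [h5]
      refine (φ.le_opNorm s).trans ?_
      calc _ ≤ ‖φ‖ * (‖algTensorMap C u‖ * ‖ξ‖ * ‖b ξ‖) := by gcongr
        _ = _ := by ring
    rcases (norm_nonneg (b ξ)).eq_or_lt with h0 | h0
    · rw [← h0]; positivity
    · exact le_of_mul_le_mul_right h4 h0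
  rw [h1]
  calc _ ≤ ‖(c : K →L[ℂ] K)‖ * ‖b‖ := norm_opTensor_le _ _
    _ ≤ ‖(c : K →L[ℂ] K)‖ * (‖φ‖ * ‖algTensorMap C u‖) := by gcongr
    _ = _ := by change ‖c‖ * _ = _; ring

/-- A bounded map of finite rank is a finite sum of bounded maps of rank one. -/
lemma exists_eq_sum_smulRight (T : C →L[ℂ] C)
    (hT : FiniteDimensional ℂ (LinearMap.range T.toLinearMap)) :
    ∃ (n : ℕ) (φ : Fin n → C →L[ℂ] ℂ) (c : Fin n → C), ∀ x, T x = ∑ k, φ k x • c k := by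
  let bs := Module.finBasis ℂ (LinearMap.range T.toLinearMap)
  refine ⟨_, fun k => (bs.coord k).toContinuousLinearMap ∘L
    T.codRestrict (LinearMap.range T.toLinearMap)
      (fun c => LinearMap.mem_range_self T.toLinearMap c), fun k => (bs k : C), fun x => ?_⟩
  have h := congrArg Subtype.val (bs.sum_repr ⟨T x, LinearMap.mem_range_self T.toLinearMap x⟩)
  rw [AddSubmonoidClass.coe_finsetSum] at h
  exact h.symm

/-- For bounded `T` of finite rank, the map `T ⊗ id` does send `c ⊗ b` to `T c ⊗ b`. -/
theorem amplify_toMinTensor_of_finiteRank (T : C →L[ℂ] C)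
    (hT : FiniteDimensional ℂ (LinearMap.range T.toLinearMap))
    (u : C ⊗[ℂ] (ell2 →L[ℂ] ell2)) :
    amplify T (toMinTensor C u) =
      toMinTensor C (TensorProduct.map T.toLinearMap LinearMap.id u) := by
  obtain ⟨n, φ, d, hsum⟩ := exists_eq_sum_smulRight T hT
  refine LinearMap.extendOfNorm_eq (denseRange_toMinTensor C)
    ⟨∑ k, ‖φ k‖ * ‖d k‖, fun u => ?_⟩ u
  change ‖algTensorMap C (TensorProduct.map T.toLinearMap LinearMap.id u)‖ ≤
    _ * ‖algTensorMap C u‖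
  have h1 : TensorProduct.map T.toLinearMap LinearMap.id u =
      ∑ k, TensorProduct.map ((φ k).smulRight (d k)).toLinearMap
        (LinearMap.id : (ell2 →L[ℂ] ell2) →ₗ[ℂ] _) u := by
    induction u with
    | zero => simp
    | add u v hu hv => simp only [map_add, hu, hv, Finset.sum_add_distrib]
    | tmul c b =>
      simp only [TensorProduct.map_tmul, ← TensorProduct.sum_tmul]
      exact congrArg (· ⊗ₜ b) (hsum c)
  rw [h1, map_sum, Finset.sum_mul]
  exact (norm_sum_le _ _).trans
    (Finset.sum_le_sum fun k _ => norm_algTensorMap_map_smulRight_le _ _ _)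

lemma amplify_add (S T : CBMap C) : amplify ((S + T : CBMap C) : C →L[ℂ] C) =
    amplify (S : C →L[ℂ] C) + amplify (T : C →L[ℂ] C) := by
  refine ContinuousLinearMap.coeFn_injective <| (denseRange_toMinTensor C).equalizer
    (ContinuousLinearMap.continuous _) (ContinuousLinearMap.continuous _) (funext fun u => ?_)
  simp only [Function.comp_apply, add_apply, amplify_toMinTensor, ← map_add]
  congr 1
  induction u with
  | zero => simp
  | add u v hu hv => simp only [map_add] at *; rw [hu, hv]; abel
  | tmul c b => simp [TensorProduct.add_tmul]

lemma amplify_smul (z : ℂ) (T : CBMap C) : amplify ((z • T : CBMap C) : C →L[ℂ] C) =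
    z • amplify (T : C →L[ℂ] C) := by
  refine ContinuousLinearMap.coeFn_injective <| (denseRange_toMinTensor C).equalizer
    (ContinuousLinearMap.continuous _) (ContinuousLinearMap.continuous _) (funext fun u => ?_)
  simp only [Function.comp_apply, smul_apply, amplify_toMinTensor, ← map_smul]
  congr 1
  induction u with
  | zero => simp
  | add u v hu hv => simp only [map_add, smul_add] at *; rw [hu, hv]
  | tmul c b => simp [TensorProduct.smul_tmul']

/-- The functional `ω_{x,ψ}(T) = ψ((T ⊗ id) x)` on `CB(C)`, for `x ∈ C ⊗ B(ℓ²)` and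
`ψ ∈ (C ⊗ B(ℓ²))^*`. -/
def omega (x : minTensor C) (ψ : minTensor C →L[ℂ] ℂ) : CBMap C →ₗ[ℂ] ℂ where
  toFun T := ψ (amplify (T : C →L[ℂ] C) x)
  map_add' S T := by rw [amplify_add, add_apply, map_add]
  map_smul' z T := by rw [amplify_smul, smul_apply, map_smul, RingHom.id_apply]

end Tensor

/-! ### The strong operator approximation property -/

/-- A concrete C*-algebra `C ⊆ B(K)` has the strong operator approximation property (SOAP): there
is a net `(Φᵢ)` of bounded finite rank maps on `C` with `(Φᵢ ⊗ id) x → x` in norm for every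
`x ∈ C ⊗ B(ℓ²)`. -/
def HasSOAP {K : Type u} [NormedAddCommGroup K] [InnerProductSpace ℂ K] [CompleteSpace K]
    (C : StarSubalgebra ℂ (K →L[ℂ] K)) : Prop :=
  ∃ (ι : Type u) (_ : Preorder ι) (_ : IsDirected ι (· ≤ ·)) (_ : Nonempty ι)
    (Φ : ι → C →L[ℂ] C),
    (∀ i, FiniteDimensional ℂ (LinearMap.range (Φ i).toLinearMap)) ∧
    ∀ x : minTensor C, Tendsto (fun i => amplify (Φ i) x) atTop (𝓝 x)

section CrossedProduct

variable {G : Type*} [Group G] {H : Type*} [NormedAddCommGroup H] [InnerProductSpace ℂ H]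

variable (H) in
/-- The left translation `λ_r` on `ℓ²(G, H)`: `(λ_r ξ)(s) = ξ(r⁻¹ s)`. -/
def lam (r : G) : lp (fun _ : G => H) 2 →L[ℂ] lp (fun _ : G => H) 2 :=
  LinearMap.mkContinuous
    { toFun := fun ξ => ⟨fun s => ξ (r⁻¹ * s), memℓp_gen <|
        (Equiv.mulLeft r⁻¹).summable_iff.2 ((lp.memℓp ξ).summable (by norm_num))⟩
      map_add' := fun ξ η => by ext; rfl
      map_smul' := fun a ξ => by ext; rfl } 1 (fun ξ => by
        rw [one_mul, lp.norm_eq_tsum_rpow (by norm_num), lp.norm_eq_tsum_rpow (by norm_num)]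
        exact le_of_eq (congrArg (· ^ _)
          ((Equiv.mulLeft r⁻¹).tsum_eq fun s => ‖ξ s‖ ^ (2 : ENNReal).toReal)))

@[simp] lemma lam_apply (r : G) (ξ : lp (fun _ : G => H) 2) (s : G) :
    lam H r ξ s = ξ (r⁻¹ * s) := rfl

variable [CompleteSpace H] {A : StarSubalgebra ℂ (H →L[ℂ] H)} [IsClosed (A : Set (H →L[ℂ] H))]
  (α : G →* (A ≃⋆ₐ[ℂ] A))

lemma norm_action_le (s : G) (a : A) : ‖((α s a : A) : H →L[ℂ] H)‖ ≤ ‖a‖ :=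
  NonUnitalStarAlgHom.norm_apply_le (α s) a

/-- The representation `π` of `A` on `ℓ²(G, H)`: `(π(a) ξ)(s) = α_{s⁻¹}(a) ξ(s)`. -/
def piRep (a : A) : lp (fun _ : G => H) 2 →L[ℂ] lp (fun _ : G => H) 2 :=
  lp.mapCLM 2 (fun s => ((α s⁻¹ a : A) : H →L[ℂ] H)) (norm_nonneg a)
    (fun s => norm_action_le α s⁻¹ a)

@[simp] lemma piRep_apply (a : A) (ξ : lp (fun _ : G => H) 2) (s : G) :
    piRep α a ξ s = ((α s⁻¹ a : A) : H →L[ℂ] H) (ξ s) := rfl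

lemma norm_piRep_le (a : A) : ‖piRep α a‖ ≤ ‖a‖ :=
  lp.norm_mapCLM_le 2 _ (norm_nonneg a) _

lemma norm_lam_le (r : G) : ‖lam H r‖ ≤ 1 := LinearMap.mkContinuous_norm_le _ zero_le_one _

lemma lam_mul_piRep (r : G) (a : A) : lam H r * piRep α a = piRep α (α r a) * lam H r := by
  ext ξ s
  simp [ContinuousLinearMap.mul_def, mul_inv_rev]

lemma lam_mul_lam (r s : G) : lam H r * lam H s = lam H (r * s) := by
  ext ξ t
  simp [ContinuousLinearMap.mul_def, mul_assoc]

lemma piRep_mul (a b : A) : piRep α (a * b) = piRep α a * piRep α b := by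
  ext ξ s
  simp [ContinuousLinearMap.mul_def]

lemma piRep_one : piRep α 1 = 1 := by
  ext ξ s
  simp

lemma piRep_add (a b : A) : piRep α (a + b) = piRep α a + piRep α b := by
  ext ξ s
  simp

lemma piRep_smul (z : ℂ) (a : A) : piRep α (z • a) = z • piRep α a := by
  ext ξ s
  simp

lemma lam_one : lam H (1 : G) = 1 := by
  ext ξ s
  simp

lemma star_lam (r : G) : star (lam H r) = lam H r⁻¹ := by
  rw [ContinuousLinearMap.star_eq_adjoint, eq_comm, ContinuousLinearMap.eq_adjoint_iff]
  intro ξ η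
  rw [lp.inner_eq_tsum, lp.inner_eq_tsum,
    ← (Equiv.mulLeft r⁻¹).tsum_eq fun s => inner ℂ ((lam H r⁻¹ ξ : lp (fun _ : G => H) 2) s) (η s)]
  simp

lemma star_piRep (a : A) : star (piRep α a) = piRep α (star a) := by
  rw [ContinuousLinearMap.star_eq_adjoint, eq_comm, ContinuousLinearMap.eq_adjoint_iff]
  intro ξ η
  rw [lp.inner_eq_tsum, lp.inner_eq_tsum]
  refine tsum_congr fun s => ?_
  rw [piRep_apply, piRep_apply, map_star, StarMemClass.coe_star,
    ContinuousLinearMap.star_eq_adjoint, ContinuousLinearMap.adjoint_inner_left]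

/-- The integrated form `π ⋊ λ (f) = ∑_s π(f(s)) λ_s` for `f : G → A`; the sum converges in norm
when `f ∈ ℓ¹(G, A)`. -/
def integratedForm (f : G → A) : lp (fun _ : G => H) 2 →L[ℂ] lp (fun _ : G => H) 2 :=
  ∑' s, piRep α (f s) * lam H s

lemma summable_integratedForm {f : G → A} (hf : Summable fun s => ‖f s‖) :
    Summable fun s => piRep α (f s) * lam H s := by
  refine Summable.of_norm_bounded hf fun s => (norm_mul_le _ _).trans ?_
  exact (mul_le_mul (norm_piRep_le α _) (norm_lam_le s) (norm_nonneg _) (norm_nonneg _)).trans_eq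
    (mul_one _)

variable (G A) in
/-- `ℓ¹(G, A)`: the functions `f : G → A` with `∑_s ‖f(s)‖ < ∞`. -/
def l1 : Set (G → A) := {f | Summable fun s => ‖f s‖}

/-- The *-algebra of finite sums `∑ π(a_s) λ_s`. -/
def finiteSums : StarSubalgebra ℂ (lp (fun _ : G => H) 2 →L[ℂ] lp (fun _ : G => H) 2) where
  carrier := Submodule.span ℂ {x | ∃ (a : A) (r : G), x = piRep α a * lam H r}
  add_mem' := Submodule.add_mem _
  zero_mem' := Submodule.zero_mem _
  one_mem' := Submodule.subset_span ⟨1, 1, by rw [piRep_one, lam_one, one_mul]⟩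
  algebraMap_mem' := fun z => by
    rw [Algebra.algebraMap_eq_smul_one]
    exact Submodule.smul_mem _ _
      (Submodule.subset_span ⟨1, 1, by rw [piRep_one, lam_one, one_mul]⟩)
  mul_mem' := by
    intro x y hx hy
    have h := Submodule.mul_mem_mul hx hy
    rw [Submodule.span_mul_span] at h
    refine Submodule.span_mono ?_ h
    rintro _ ⟨_, ⟨a, r, rfl⟩, _, ⟨b, s, rfl⟩, rfl⟩
    refine ⟨a * α r b, r * s, ?_⟩
    change piRep α a * lam H r * (piRep α b * lam H s) = _
    rw [mul_assoc, ← mul_assoc (lam H r), lam_mul_piRep, piRep_mul, ← lam_mul_lam]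
    simp only [mul_assoc]
  star_mem' := by
    intro x hx
    refine Submodule.span_induction ?_ ?_ ?_ ?_ hx
    · rintro _ ⟨a, r, rfl⟩
      refine Submodule.subset_span ⟨α r⁻¹ (star a), r⁻¹, ?_⟩
      rw [star_mul, star_lam, star_piRep, lam_mul_piRep]
    · rw [star_zero]; exact Submodule.zero_mem _
    · intro x y _ _ hx hy
      rw [star_add]; exact Submodule.add_mem _ hx hy
    · intro z x _ hx
      rw [star_smul]; exact Submodule.smul_mem _ _ hx

lemma closure_image_integratedForm :
    closure (integratedForm α '' l1 G A) = ((finiteSums α).topologicalClosure : Set _) := by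
  rw [StarSubalgebra.topologicalClosure_coe]
  apply Set.Subset.antisymm
  · refine closure_minimal ?_ isClosed_closure
    rintro _ ⟨f, hf, rfl⟩
    refine isClosed_closure.mem_of_tendsto (summable_integratedForm α hf).hasSum
      (Filter.Eventually.of_forall fun t => subset_closure ?_)
    exact Submodule.sum_mem _ fun s _ => Submodule.subset_span ⟨f s, s, rfl⟩
  · have h0 : piRep α (0 : A) = 0 := by simpa using piRep_smul α 0 (0 : A)
    refine closure_mono fun x hx => ?_
    refine Submodule.span_induction ?_ ?_ ?_ ?_ hx
    · classical
      rintro _ ⟨a, r, rfl⟩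
      have hs : ∀ s, s ≠ r → Pi.single (M := fun _ => A) r a s = 0 := fun s hs => by simp [hs]
      refine ⟨Pi.single r a, ?_, ?_⟩
      · exact summable_of_ne_finset_zero (s := {r}) fun s hsr => by
          rw [hs s (by simpa using hsr), norm_zero]
      · rw [integratedForm, tsum_eq_single r fun s hsr => by rw [hs s hsr, h0, zero_mul],
          Pi.single_eq_same]
    · refine ⟨0, ?_, ?_⟩
      · exact summable_of_ne_finset_zero (s := ∅) fun s _ => norm_zero
      · simp [integratedForm, h0]
    · rintro _ _ _ _ ⟨f, hf, rfl⟩ ⟨g, hg, rfl⟩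
      refine ⟨f + g, Summable.of_nonneg_of_le (fun _ => norm_nonneg _)
        (fun _ => norm_add_le _ _) (hf.add hg), ?_⟩
      simp only [integratedForm, Pi.add_apply, piRep_add, add_mul]
      exact (summable_integratedForm α hf).tsum_add (summable_integratedForm α hg)
    · rintro z _ _ ⟨f, hf, rfl⟩
      refine ⟨z • f, Summable.of_nonneg_of_le (fun _ => norm_nonneg _)
        (fun s => norm_smul_le z (f s : H →L[ℂ] H)) (hf.mul_left ‖z‖), ?_⟩
      simp only [integratedForm, Pi.smul_apply, piRep_smul, smul_mul_assoc]
      exact (summable_integratedForm α hf).tsum_const_smul z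

/-- The reduced crossed product `A ⋊_{α,r} G ⊆ B(ℓ²(G, H))`: the norm closure of
`π ⋊ λ (ℓ¹(G, A))`. -/
def reducedCrossedProduct :
    StarSubalgebra ℂ (lp (fun _ : G => H) 2 →L[ℂ] lp (fun _ : G => H) 2) :=
  (finiteSums α).topologicalClosure.copy (closure (integratedForm α '' l1 G A))
    (closure_image_integratedForm α)

lemma isClosed_reducedCrossedProduct : IsClosed (reducedCrossedProduct α : Set
    (lp (fun _ : G => H) 2 →L[ℂ] lp (fun _ : G => H) 2)) := isClosed_closure

lemma integratedForm_mem {f : G → A} (hf : f ∈ l1 G A) :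
    integratedForm α f ∈ reducedCrossedProduct α := subset_closure ⟨f, hf, rfl⟩

/-! ### Herz–Schur multipliers -/

/-- `S = S_F`: the map `S` on `A ⋊_{α,r} G` satisfies `S(π ⋊ λ (f)) = π ⋊ λ (F · f)` for all
`f ∈ ℓ¹(G, A)`, where `(F · f)(r) = F(r)(f(r))`. -/
def IsMultiplierMap (F : G → CBMap A) (S : CBMap (reducedCrossedProduct α)) : Prop :=
  ∀ (f : G → A) (hf : f ∈ l1 G A),
    ((S : reducedCrossedProduct α →L[ℂ] reducedCrossedProduct α)
      ⟨integratedForm α f, integratedForm_mem α hf⟩ : lp (fun _ : G => H) 2 →L[ℂ] _) =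
      integratedForm α fun r => (F r : A →L[ℂ] A) (f r)

/-- `F : G → CB(A)` is a Herz–Schur `(A, G, α)`-multiplier: it is bounded for the cb norm, and
`π ⋊ λ (f) ↦ π ⋊ λ (F · f)` extends to a completely bounded map `S_F` on `A ⋊_{α,r} G`. -/
structure IsHerzSchurMultiplier (F : G → CBMap A) : Prop where
  bounded : ∃ M : ℝ, ∀ r, CBBound (F r : A →L[ℂ] A) M
  extends_cb : ∃ S : CBMap (reducedCrossedProduct α), IsMultiplierMap α F S

/-- The space of Herz–Schur `(A, G, α)`-multipliers. -/
def HerzSchurMultiplier : Type _ := {F : G → CBMap A // IsHerzSchurMultiplier α F}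

variable {α} in
/-- The completely bounded map `S_F` on `A ⋊_{α,r} G` of a Herz–Schur multiplier `F`. -/
def HerzSchurMultiplier.toCBMap (F : HerzSchurMultiplier α) : CBMap (reducedCrossedProduct α) :=
  F.2.extends_cb.choose

lemma HerzSchurMultiplier.isMultiplierMap_toCBMap (F : HerzSchurMultiplier α) :
    IsMultiplierMap α F.1 F.toCBMap := F.2.extends_cb.choose_spec

/-- `S_F` is uniquely determined by `F`. -/
lemma IsMultiplierMap.unique {F : G → CBMap A} {S T : CBMap (reducedCrossedProduct α)}
    (hS : IsMultiplierMap α F S) (hT : IsMultiplierMap α F T) : S = T := by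
  refine Subtype.ext (ContinuousLinearMap.ext fun x => ?_)
  have hx : x ∈ closure (Subtype.val ⁻¹' (integratedForm α '' l1 G A) :
      Set (reducedCrossedProduct α)) := by
    rw [Metric.mem_closure_iff]
    intro ε hε
    obtain ⟨_, ⟨f, hf, rfl⟩, hd⟩ := Metric.mem_closure_iff.1 (show (x : _ →L[ℂ] _) ∈
      closure (integratedForm α '' l1 G A) from x.2) ε hε
    exact ⟨⟨integratedForm α f, integratedForm_mem α hf⟩, ⟨f, hf, rfl⟩, hd⟩
  have hc : IsClosed {x : reducedCrossedProduct α |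
      (S : reducedCrossedProduct α →L[ℂ] reducedCrossedProduct α) x =
        (T : reducedCrossedProduct α →L[ℂ] reducedCrossedProduct α) x} :=
    isClosed_eq (ContinuousLinearMap.continuous _) (ContinuousLinearMap.continuous _)
  refine closure_minimal ?_ hc hx
  rintro ⟨_, _⟩ ⟨f, hf, rfl⟩
  exact Subtype.ext ((hS f hf).trans (hT f hf).symm)

/-! ### The approximation property of a C*-dynamical system -/

/-- The space `Q(A, G, α)` of functionals `ω_{x,ψ}` with `x ∈ (A ⋊_{α,r} G) ⊗ B(ℓ²)` and
`ψ ∈ ((A ⋊_{α,r} G) ⊗ B(ℓ²))^*`. -/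
def Q : Set (CBMap (reducedCrossedProduct α) →ₗ[ℂ] ℂ) :=
  {ω | ∃ x ψ, ω = omega x ψ}

end CrossedProduct

/-- The C*-dynamical system `(A, G, α)` has the approximation property (AP): there is a net of
finitely supported Herz–Schur `(A, G, α)`-multipliers `Fᵢ`, with every `Fᵢ(r)` of finite rank, such
that `ω(Fᵢ) := ω(S_{Fᵢ}) → ω(id)` for every `ω ∈ Q(A, G, α)`. -/
def HasAP {H : Type u} [NormedAddCommGroup H] [InnerProductSpace ℂ H] [CompleteSpace H]
    {G : Type v} [Group G] {A : StarSubalgebra ℂ (H →L[ℂ] H)} [IsClosed (A : Set (H →L[ℂ] H))]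
    (α : G →* (A ≃⋆ₐ[ℂ] A)) : Prop :=
  ∃ (ι : Type (max u v)) (_ : Preorder ι) (_ : IsDirected ι (· ≤ ·)) (_ : Nonempty ι)
    (F : ι → HerzSchurMultiplier α),
    (∀ i, {r : G | (F i).1 r ≠ 0}.Finite) ∧
    (∀ i r, FiniteDimensional ℂ
      (LinearMap.range ((F i).1 r : A →L[ℂ] A).toLinearMap)) ∧
    ∀ ω ∈ Q α, Tendsto (fun i => ω (F i).toCBMap) atTop
      (𝓝 (ω (CBMap.id (reducedCrossedProduct α))))

end CrossedProductAP

end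

noncomputable section

namespace CrossedProductAP

section ConjugationSums

variable {I : Type*} {E : Type*} [NormedAddCommGroup E] [InnerProductSpace ℂ E]

/-- The family `(Tᵢ)` is a contractive column: `∑ ‖Tᵢ v‖² ≤ ‖v‖²` for all `v`. -/
def IsColumnContraction (T : I → E →L[ℂ] E) : Prop :=
  ∀ (s : Finset I) (v : E), ∑ i ∈ s, ‖T i v‖ ^ 2 ≤ ‖v‖ ^ 2

/-- A contractive column `(Tᵢ)` as an operator `v ↦ (Tᵢ v)ᵢ`. -/
def column (T : I → E →L[ℂ] E) (hT : IsColumnContraction T) :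
    E →L[ℂ] lp (fun _ : I => E) 2 :=
  LinearMap.mkContinuous
    { toFun := fun v => ⟨fun i => T i v, memℓp_gen' (C := ‖v‖ ^ 2) fun s => by
        simpa using hT s v⟩
      map_add' := fun v w => by ext i; exact map_add (T i) v w
      map_smul' := fun a v => by ext i; exact map_smul (T i) a v } 1 fun v => by
        rw [one_mul]
        exact lp.norm_le_of_forall_sum_le (by norm_num) (norm_nonneg v) fun s => by
          simpa using hT s v

lemma norm_column_le (T : I → E →L[ℂ] E) (hT : IsColumnContraction T) : ‖column T hT‖ ≤ 1 :=
  LinearMap.mkContinuous_norm_le _ zero_le_one _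

variable [CompleteSpace E]

/-- The map `X ↦ ∑ᵢ Tᵢ* X Tᵢ` on `B(E)` given by a contractive column. -/
def conjSum (T : I → E →L[ℂ] E) (hT : IsColumnContraction T) :
    (E →L[ℂ] E) →L[ℂ] (E →L[ℂ] E) :=
  LinearMap.mkContinuous
    { toFun := fun X => (column T hT).adjoint ∘L
        lp.mapCLM 2 (fun _ : I => X) (norm_nonneg X) (fun _ => le_rfl) ∘L column T hT
      map_add' := fun X Y => by
        ext v
        rw [add_apply]
        simp only [ContinuousLinearMap.comp_apply, ← map_add]
        congr 1
      map_smul' := fun a X => by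
        ext v
        rw [RingHom.id_apply, smul_apply]
        simp only [ContinuousLinearMap.comp_apply]
        rw [← map_smul]
        congr 1 } 1 fun X => by
    have h1 := norm_column_le T hT
    have h2 : ‖(column T hT).adjoint‖ ≤ 1 := by rwa [LinearIsometryEquiv.norm_map]
    have h3 := lp.norm_mapCLM_le 2 (fun _ : I => X) (norm_nonneg X) (fun _ => le_rfl)
    calc _ ≤ ‖(column T hT).adjoint‖ * (‖lp.mapCLM 2 (fun _ : I => X) (norm_nonneg X)
          (fun _ => le_rfl)‖ * ‖column T hT‖) :=
          (ContinuousLinearMap.opNorm_comp_le _ _).trans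
            (by gcongr; exact ContinuousLinearMap.opNorm_comp_le _ _)
      _ ≤ 1 * (‖X‖ * 1) := by gcongr
      _ = _ := by ring

lemma norm_conjSum_le (T : I → E →L[ℂ] E) (hT : IsColumnContraction T) : ‖conjSum T hT‖ ≤ 1 :=
  LinearMap.mkContinuous_norm_le _ zero_le_one _

lemma inner_conjSum (T : I → E →L[ℂ] E) (hT : IsColumnContraction T) (X : E →L[ℂ] E) (v w : E) :
    inner ℂ w (conjSum T hT X v) = ∑' i, inner ℂ (T i w) (X (T i v)) := by
  change inner ℂ w ((column T hT).adjoint _) = _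
  rw [ContinuousLinearMap.adjoint_inner_right, lp.inner_eq_tsum]
  rfl

end ConjugationSums

section FiniteRank

variable {K : Type*} [NormedAddCommGroup K] [InnerProductSpace ℂ K] [CompleteSpace K]
  {C : StarSubalgebra ℂ (K →L[ℂ] K)}

/-- The matrix unit `eᵢⱼ` in `B(ℓ²)`. -/
def matrixUnit (i j : ℕ) : ell2 →L[ℂ] ell2 := (innerSL ℂ (basisVec j)).smulRight (basisVec i)

lemma matrixUnit_apply (i j : ℕ) (v : ell2) : matrixUnit i j v = v j • basisVec i := by
  simp [matrixUnit, inner_basisVec]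

/-- `colIncl` as a bounded operator. -/
def colInclL (K : Type*) [NormedAddCommGroup K] [InnerProductSpace ℂ K] [CompleteSpace K] (n : ℕ) :
    PiLp 2 (fun _ : Fin n => K) →L[ℂ] HilbertTensor K :=
  LinearIsometry.toContinuousLinearMap
    { toFun := colIncl n
      map_add' := colIncl_add n
      map_smul' := colIncl_smul n
      norm_map' := norm_colIncl n }

@[simp] lemma colInclL_apply (n : ℕ) (ξ : PiLp 2 (fun _ : Fin n => K)) :
    colInclL K n ξ = colIncl n ξ := rfl

lemma norm_colInclL_le (n : ℕ) : ‖colInclL K n‖ ≤ 1 :=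
  LinearIsometry.norm_toContinuousLinearMap_le _

lemma basisVec_apply (i j : ℕ) : (basisVec i : ell2) j = if j = i then 1 else 0 := by
  simp [basisVec, lp.single_apply, Pi.single_apply]

lemma colInclL_adjoint_incl_tmul (n : ℕ) (k : K) (v : ell2) (j : Fin n) :
    (colInclL K n).adjoint (HilbertTensor.incl K (k ⊗ₜ v)) j = v j • k := by
  classical
  refine ext_inner_left ℂ fun w => ?_
  have h : inner ℂ w ((colInclL K n).adjoint (HilbertTensor.incl K (k ⊗ₜ v)) j) =
      inner ℂ (PiLp.single 2 j w : PiLp 2 (fun _ : Fin n => K))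
        ((colInclL K n).adjoint (HilbertTensor.incl K (k ⊗ₜ v))) := by
    rw [PiLp.inner_apply, Finset.sum_eq_single j]
    · simp
    · intro i _ hi
      simp [hi]
    · simp
  rw [h, ContinuousLinearMap.adjoint_inner_right, colInclL_apply, colIncl,
    Finset.sum_eq_single j, LinearIsometry.inner_map_map, TensorProduct.inner_tmul]
  · simp [inner_basisVec, inner_smul_right, mul_comm]
  · intro i _ hi
    simp [hi]
  · simp

/-- A matrix over `C` as an element of `C ⊙ B(ℓ²)`. -/
def ofMatrix {n : ℕ} (x : Matrix (Fin n) (Fin n) C) : C ⊗[ℂ] (ell2 →L[ℂ] ell2) :=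
  ∑ i, ∑ j, x i j ⊗ₜ matrixUnit i j

lemma corner_ofMatrix {n : ℕ} (x : Matrix (Fin n) (Fin n) C) : corner n (ofMatrix x) = x := by
  ext i j : 2
  simp only [corner, ofMatrix, Matrix.of_apply, map_sum, slice_tmul, matrixUnit_apply,
    basisVec_apply]
  rw [Finset.sum_eq_single i, Finset.sum_eq_single j]
  · simp [basisVec_apply]
  · intro k _ hk
    simp [Fin.val_inj, hk]
  · simp
  · intro k _ hk
    refine Finset.sum_eq_zero fun l _ => ?_
    by_cases h : l = j <;> simp [basisVec_apply, Fin.val_inj, h, hk.symm]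
  · simp

lemma algTensorMap_ofMatrix {n : ℕ} (x : Matrix (Fin n) (Fin n) C) :
    algTensorMap C (ofMatrix x) = colInclL K n ∘L
      blockOperator (x.map fun c => (c : K →L[ℂ] K)) ∘L (colInclL K n).adjoint := by
  refine hilbertTensor_ext fun v => ?_
  induction v with
  | zero => simp only [map_zero]
  | add v w hv hw => simp only [map_add, hv, hw]
  | tmul k v =>
    simp only [ContinuousLinearMap.comp_apply, colInclL_apply, colIncl, blockOperator_apply,
      colInclL_adjoint_incl_tmul, ofMatrix, map_sum, algTensorMap_tmul, sum_apply,
      opTensor_incl, TensorProduct.sum_tmul, Matrix.map_apply, map_smul]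
    refine Finset.sum_congr rfl fun i _ => Finset.sum_congr rfl fun j _ => ?_
    simp [matrixUnit_apply, TensorProduct.smul_tmul]

lemma norm_algTensorMap_ofMatrix_le {n : ℕ} (x : Matrix (Fin n) (Fin n) C) :
    ‖algTensorMap C (ofMatrix x)‖ ≤ ‖blockOperator (x.map fun c => (c : K →L[ℂ] K))‖ := by
  rw [algTensorMap_ofMatrix]
  have h1 := norm_colInclL_le (K := K) n
  have h2 : ‖(colInclL K n).adjoint‖ ≤ 1 := by rwa [LinearIsometryEquiv.norm_map]
  calc _ ≤ ‖colInclL K n‖ * (‖blockOperator (x.map fun c => (c : K →L[ℂ] K))‖ *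
        ‖(colInclL K n).adjoint‖) := (ContinuousLinearMap.opNorm_comp_le _ _).trans
            (by gcongr; exact ContinuousLinearMap.opNorm_comp_le _ _)
    _ ≤ 1 * (‖blockOperator (x.map fun c => (c : K →L[ℂ] K))‖ * 1) := by gcongr
    _ = _ := by ring

/-- Bounded maps of rank one are completely bounded. -/
lemma CBBound.smulRight (φ : C →L[ℂ] ℂ) (c : C) : CBBound (φ.smulRight c) (‖φ‖ * ‖c‖) := by
  intro n x
  have h := norm_corner_le n (TensorProduct.map (φ.smulRight c).toLinearMap LinearMap.id
    (ofMatrix x))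
  have hc : corner n (TensorProduct.map (φ.smulRight c).toLinearMap LinearMap.id (ofMatrix x)) =
      x.map (φ.smulRight c) := by
    refine Matrix.ext fun i j => ?_
    rw [corner, Matrix.of_apply, slice_map]
    exact congrArg (φ.smulRight c) (congrFun (congrFun (corner_ofMatrix x) i) j)
  rw [hc] at h
  refine h.trans ((norm_algTensorMap_map_smulRight_le φ c _).trans ?_)
  gcongr
  exact norm_algTensorMap_ofMatrix_le x

lemma CBBound.add {S T : C →L[ℂ] C} {M N : ℝ} (hS : CBBound S M) (hT : CBBound T N) :
    CBBound (S + T) (M + N) := by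
  intro n x
  have h : (x.map fun c => ((S + T) c : K →L[ℂ] K)) =
      (x.map fun c => (S c : K →L[ℂ] K)) + (x.map fun c => (T c : K →L[ℂ] K)) := by
    ext; simp
  rw [h, blockOperator_add, add_mul]
  exact (norm_add_le _ _).trans (add_le_add (hS n x) (hT n x))

lemma CBBound.zero : CBBound (0 : C →L[ℂ] C) 0 := by
  intro n x
  have h : (x.map fun c => ((0 : C →L[ℂ] C) c : K →L[ℂ] K)) = 0 := by ext; simp
  rw [h, show blockOperator (0 : Matrix (Fin n) (Fin n) (K →L[ℂ] K)) = 0 by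
    ext; simp [blockOperator_apply]]
  simp

lemma CBBound.sum {κ : Type*} (s : Finset κ) {T : κ → C →L[ℂ] C} {M : κ → ℝ}
    (h : ∀ k ∈ s, CBBound (T k) (M k)) : CBBound (∑ k ∈ s, T k) (∑ k ∈ s, M k) := by
  classical
  induction s using Finset.induction_on with
  | empty => simpa using CBBound.zero
  | insert k s hk ih =>
    rw [Finset.sum_insert hk, Finset.sum_insert hk]
    exact (h k (Finset.mem_insert_self k s)).add
      (ih fun l hl => h l (Finset.mem_insert_of_mem hl))

lemma amplify_id : amplify (ContinuousLinearMap.id ℂ C) = ContinuousLinearMap.id ℂ _ := by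
  refine ContinuousLinearMap.coeFn_injective <| (denseRange_toMinTensor C).equalizer
    (ContinuousLinearMap.continuous _) (ContinuousLinearMap.continuous _) (funext fun u => ?_)
  have h := amplify_toMinTensor (CBMap.id C) u
  simp only [CBMap.id] at h
  simp only [Function.comp_apply, h]
  simp

/-- Two finite sums of rank one maps with close coefficients have close amplifications. -/
lemma norm_amplify_sum_smulRight_sub_le {n : ℕ} (φ : Fin n → C →L[ℂ] ℂ) (c d : Fin n → C)
    (x : minTensor C) :
    ‖amplify (∑ k, (φ k).smulRight (c k)) x - amplify (∑ k, (φ k).smulRight (d k)) x‖ ≤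
      (∑ k, ‖φ k‖ * ‖c k - d k‖) * ‖x‖ := by
  have hcb : ∀ c : Fin n → C, ∑ k, (φ k).smulRight (c k) ∈ CBMap C := fun c =>
    ⟨_, CBBound.sum Finset.univ fun k _ => CBBound.smulRight (φ k) (c k)⟩
  refine (denseRange_toMinTensor C).induction_on (p := fun x =>
    ‖amplify (∑ k, (φ k).smulRight (c k)) x - amplify (∑ k, (φ k).smulRight (d k)) x‖ ≤
      (∑ k, ‖φ k‖ * ‖c k - d k‖) * ‖x‖) x (isClosed_le (by fun_prop) (by fun_prop)) fun u => ?_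
  rw [amplify_toMinTensor ⟨_, hcb c⟩, amplify_toMinTensor ⟨_, hcb d⟩, ← map_sub]
  have h : TensorProduct.map (∑ k, (φ k).smulRight (c k)).toLinearMap LinearMap.id u -
      TensorProduct.map (∑ k, (φ k).smulRight (d k)).toLinearMap LinearMap.id u =
      ∑ k, TensorProduct.map ((φ k).smulRight (c k - d k)).toLinearMap
        (LinearMap.id : (ell2 →L[ℂ] ell2) →ₗ[ℂ] _) u := by
    induction u with
    | zero => simp
    | add u v hu hv =>
      simp only [map_add, Finset.sum_add_distrib, ← hu, ← hv]
      abel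
    | tmul a b =>
      simp only [TensorProduct.map_tmul, ← TensorProduct.sum_tmul, ← TensorProduct.sub_tmul]
      congr 1
      simp [smul_sub]
  rw [h]
  change ‖algTensorMap C _‖ ≤ _ * ‖algTensorMap C u‖
  rw [map_sum, Finset.sum_mul]
  exact (norm_sum_le _ _).trans
    (Finset.sum_le_sum fun k _ => norm_algTensorMap_map_smulRight_le _ _ _)

end FiniteRank

section TensorInner

variable {K : Type*} [NormedAddCommGroup K] [InnerProductSpace ℂ K]
  {K' : Type*} [NormedAddCommGroup K'] [InnerProductSpace ℂ K']

lemma HilbertTensor.ext_tmul {F : Type*} [NormedAddCommGroup F] [NormedSpace ℂ F]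
    {S T : HilbertTensor K →L[ℂ] F}
    (h : ∀ k v, S (HilbertTensor.incl K (k ⊗ₜ v)) = T (HilbertTensor.incl K (k ⊗ₜ v))) : S = T := by
  refine ContinuousLinearMap.coeFn_injective <|
    (HilbertTensor.denseRange_incl K).equalizer S.continuous T.continuous (funext fun u => ?_)
  simp only [Function.comp_apply]
  induction u with
  | zero => simp only [map_zero]
  | add u v hu hv => simp only [map_add, hu, hv]
  | tmul k v => exact h k v

lemma HilbertTensor.eq_of_inner {x y : HilbertTensor K}
    (h : ∀ k v, inner ℂ (HilbertTensor.incl K (k ⊗ₜ v)) x =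
      inner ℂ (HilbertTensor.incl K (k ⊗ₜ v)) y) : x = y := by
  have h' : innerSL ℂ x = innerSL ℂ y := HilbertTensor.ext_tmul fun k v => by
    simpa using congrArg (starRingEnd ℂ) (h k v)
  refine ext_inner_right ℂ fun z => ?_
  simpa using congrArg (fun f => f z) h'

lemma HilbertTensor.ext_inner {S T : HilbertTensor K →L[ℂ] HilbertTensor K'}
    (h : ∀ k v k' v', inner ℂ (HilbertTensor.incl K' (k' ⊗ₜ v'))
        (S (HilbertTensor.incl K (k ⊗ₜ v))) =
      inner ℂ (HilbertTensor.incl K' (k' ⊗ₜ v')) (T (HilbertTensor.incl K (k ⊗ₜ v)))) : S = T :=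
  HilbertTensor.ext_tmul fun k v => HilbertTensor.eq_of_inner fun k' v' => h k v k' v'

lemma opTensor_incl_tmul (c : K →L[ℂ] K) (b : ell2 →L[ℂ] ell2) (k : K) (v : ell2) :
    opTensor c b (HilbertTensor.incl K (k ⊗ₜ v)) = HilbertTensor.incl K (c k ⊗ₜ b v) :=
  opTensor_incl c b _

lemma inner_incl_tmul (k k' : K) (v v' : ell2) :
    inner ℂ (HilbertTensor.incl K (k ⊗ₜ v)) (HilbertTensor.incl K (k' ⊗ₜ v')) =
      inner ℂ k k' * inner ℂ v v' := by
  rw [LinearIsometry.inner_map_map, TensorProduct.inner_tmul]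

lemma IsColumnContraction.norm_le {I E : Type*} [NormedAddCommGroup E] [InnerProductSpace ℂ E]
    {T : I → E →L[ℂ] E} (hT : IsColumnContraction T) (i : I) : ‖T i‖ ≤ 1 := by
  refine ContinuousLinearMap.opNorm_le_bound _ zero_le_one fun v => ?_
  have h := hT {i} v
  rw [Finset.sum_singleton] at h
  rw [one_mul]
  exact (sq_le_sq₀ (norm_nonneg _) (norm_nonneg _)).1 h

/-- The amplification `1 ⊗ Bᵢ` of a contractive column is a contractive column. -/
lemma IsColumnContraction.one_tensor [CompleteSpace K] {I : Type*} {B : I → ell2 →L[ℂ] ell2}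
    (hB : IsColumnContraction B) :
    IsColumnContraction fun i => opTensor (1 : K →L[ℂ] K) (B i) := by
  intro s v
  have hB' : IsColumnContraction fun i : s => B i := fun t w => by
    have h := hB (t.map (Function.Embedding.subtype _)) w
    rwa [Finset.sum_map] at h
  set D := column _ hB'
  have hD : ‖D‖ ≤ 1 := norm_column_le _ hB'
  have hS : ‖D.adjoint ∘L D‖ ≤ 1 := by
    rw [ContinuousLinearMap.norm_adjoint_comp_self]
    exact mul_le_one₀ hD (norm_nonneg _) hD
  have hsum : opTensor (1 : K →L[ℂ] K) (D.adjoint ∘L D) =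
      ∑ i ∈ s, (opTensor (1 : K →L[ℂ] K) (B i)).adjoint ∘L opTensor (1 : K →L[ℂ] K) (B i) := by
    refine HilbertTensor.ext_inner fun k v k' v' => ?_
    simp only [sum_apply, ContinuousLinearMap.comp_apply, inner_sum,
      ContinuousLinearMap.adjoint_inner_right, opTensor_incl_tmul, inner_incl_tmul,
      lp.inner_eq_tsum, tsum_fintype, ← Finset.mul_sum, one_apply_eq_self]
    congr 1
    exact Finset.sum_coe_sort s fun i => inner ℂ (B i v') (B i v)
  have h1 : ((∑ i ∈ s, ‖opTensor (1 : K →L[ℂ] K) (B i) v‖ ^ 2 : ℝ) : ℂ) =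
      inner ℂ v (opTensor (1 : K →L[ℂ] K) (D.adjoint ∘L D) v) := by
    rw [hsum]
    simp only [sum_apply, ContinuousLinearMap.comp_apply, inner_sum,
      ContinuousLinearMap.adjoint_inner_right, inner_self_eq_norm_sq_to_K]
    push_cast
    rfl
  have h2 : ∑ i ∈ s, ‖opTensor (1 : K →L[ℂ] K) (B i) v‖ ^ 2 =
      ‖inner ℂ v (opTensor (1 : K →L[ℂ] K) (D.adjoint ∘L D) v)‖ := by
    rw [← h1, Complex.norm_real, Real.norm_of_nonneg (by positivity)]
  have h3 : ‖opTensor (1 : K →L[ℂ] K) (D.adjoint ∘L D)‖ ≤ 1 :=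
    (norm_opTensor_le _ _).trans
      (mul_le_one₀ ContinuousLinearMap.norm_id_le (norm_nonneg _) hS)
  calc _ = _ := h2
    _ ≤ ‖v‖ * ‖opTensor (1 : K →L[ℂ] K) (D.adjoint ∘L D) v‖ := norm_inner_le_norm _ _
    _ ≤ ‖v‖ * (1 * ‖v‖) := by gcongr; exact ContinuousLinearMap.le_of_opNorm_le _ h3 v
    _ = _ := by ring

end TensorInner

section DirectSum

variable {G : Type*} [DecidableEq G] {H : Type*} [NormedAddCommGroup H] [InnerProductSpace ℂ H]

/-- The elementary vector `δ_t ξ ⊗ v` of `ℓ²(G, H) ⊗ ℓ²`. -/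
def elem (t : G) (ξ : H) (v : ell2) : HilbertTensor (lp (fun _ : G => H) 2) :=
  HilbertTensor.incl _ (lp.single 2 t ξ ⊗ₜ v)

lemma inner_elem (s t : G) (ξ η : H) (v w : ell2) :
    inner ℂ (elem s η w) (elem t ξ v) = (if s = t then inner ℂ η ξ else 0) * inner ℂ w v := by
  rw [elem, elem, inner_incl_tmul, lp.inner_single_left, lp.single_apply, Pi.single_apply]
  split_ifs <;> simp

lemma opTensor_elem (c : lp (fun _ : G => H) 2 →L[ℂ] lp (fun _ : G => H) 2) (b : ell2 →L[ℂ] ell2)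
    (t : G) (ξ : H) (v : ell2) :
    opTensor c b (elem t ξ v) = HilbertTensor.incl _ (c (lp.single 2 t ξ) ⊗ₜ b v) :=
  opTensor_incl_tmul c b _ v

lemma elem_ext {F : Type*} [NormedAddCommGroup F] [NormedSpace ℂ F]
    {S T : HilbertTensor (lp (fun _ : G => H) 2) →L[ℂ] F}
    (h : ∀ t ξ v, S (elem t ξ v) = T (elem t ξ v)) : S = T := by
  refine HilbertTensor.ext_tmul fun k v => ?_
  have h1 : S ∘L (HilbertTensor.incl _).toContinuousLinearMap ∘L
      (TensorProduct.mkL ℂ (lp (fun _ : G => H) 2) ell2).flip v =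
      T ∘L (HilbertTensor.incl _).toContinuousLinearMap ∘L
      (TensorProduct.mkL ℂ (lp (fun _ : G => H) 2) ell2).flip v :=
    lp.ext_continuousLinearMap (by simp) fun t => by
      ext ξ
      exact h t ξ v
  exact congrArg (fun f => f k) h1

lemma eq_of_inner_elem {x y : HilbertTensor (lp (fun _ : G => H) 2)}
    (h : ∀ t ξ v, inner ℂ (elem t ξ v) x = inner ℂ (elem t ξ v) y) : x = y := by
  have h' : innerSL ℂ x = innerSL ℂ y := elem_ext fun t ξ v => by
    simpa using congrArg (starRingEnd ℂ) (h t ξ v)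
  refine ext_inner_right ℂ fun z => ?_
  simpa using congrArg (fun f => f z) h'

lemma elem_ext_inner {S T : HilbertTensor (lp (fun _ : G => H) 2) →L[ℂ]
      HilbertTensor (lp (fun _ : G => H) 2)}
    (h : ∀ t ξ v s η w, inner ℂ (elem s η w) (S (elem t ξ v)) =
      inner ℂ (elem s η w) (T (elem t ξ v))) : S = T :=
  elem_ext fun t ξ v => eq_of_inner_elem fun s η w => h t ξ v s η w

/-- The isometry `ξ ↦ δ_t ξ`. -/
def singleIsometry (H : Type*) [NormedAddCommGroup H] [InnerProductSpace ℂ H] (t : G) :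
    H →ₗᵢ[ℂ] lp (fun _ : G => H) 2 where
  toLinearMap := (lp.singleContinuousLinearMap ℂ (fun _ : G => H) 2 t).toLinearMap
  norm_map' := fun ξ => lp.norm_single (E := fun _ : G => H) (p := 2) zero_lt_two t ξ

/-- The bounded map `ξ ⊗ v ↦ δ_t ξ ⊗ v` from `H ⊗ ℓ²` to `ℓ²(G, H) ⊗ ℓ²`. -/
def summandMap (H : Type*) [NormedAddCommGroup H] [InnerProductSpace ℂ H] (t : G) :
    HilbertTensor H →L[ℂ] HilbertTensor (lp (fun _ : G => H) 2) :=
  (TensorProduct.mapL (lp.singleContinuousLinearMap ℂ (fun _ : G => H) 2 t)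
    (ContinuousLinearMap.id ℂ ell2)).completion

lemma summandMap_incl (t : G) (u : H ⊗[ℂ] ell2) :
    summandMap H t (HilbertTensor.incl H u) = HilbertTensor.incl _
      (TensorProduct.mapL (lp.singleContinuousLinearMap ℂ (fun _ : G => H) 2 t)
        (ContinuousLinearMap.id ℂ ell2) u : lp (fun _ : G => H) 2 ⊗[ℂ] ell2) :=
  ContinuousLinearMap.completion_apply_coe _ u

lemma norm_summandMap (t : G) (x : HilbertTensor H) : ‖summandMap H t x‖ = ‖x‖ := by
  refine (HilbertTensor.denseRange_incl H).induction_on (p := fun x =>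
    ‖summandMap H t x‖ = ‖x‖) x (isClosed_eq (by fun_prop) (by fun_prop)) fun u => ?_
  rw [summandMap_incl, LinearIsometry.norm_map, LinearIsometry.norm_map]
  have h : TensorProduct.mapL (lp.singleContinuousLinearMap ℂ (fun _ : G => H) 2 t)
      (ContinuousLinearMap.id ℂ ell2) u =
      TensorProduct.mapIsometry (singleIsometry H t) LinearIsometry.id u := by
    induction u with
    | zero => simp only [map_zero]
    | add u v hu hv => simp only [map_add, hu, hv]
    | tmul k v => rfl
  rw [h, LinearIsometry.norm_map]

/-- The inclusion of `H ⊗ ℓ²` in `ℓ²(G, H) ⊗ ℓ²` as the summand at `t`. -/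
def summandIncl (H : Type*) [NormedAddCommGroup H] [InnerProductSpace ℂ H] (t : G) :
    HilbertTensor H →ₗᵢ[ℂ] HilbertTensor (lp (fun _ : G => H) 2) where
  toLinearMap := (summandMap H t).toLinearMap
  norm_map' := norm_summandMap t

lemma summandIncl_incl_tmul (t : G) (ξ : H) (v : ell2) :
    summandIncl H t (HilbertTensor.incl H (ξ ⊗ₜ v)) = elem t ξ v :=
  summandMap_incl t (ξ ⊗ₜ v)

lemma orthogonalFamily_summandIncl :
    OrthogonalFamily ℂ (fun _ : G => HilbertTensor H) (summandIncl H) := by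
  intro s t hst x y
  have h : (summandIncl H s).toContinuousLinearMap.adjoint ∘L
      (summandIncl H t).toContinuousLinearMap = 0 := by
    refine HilbertTensor.ext_inner fun k v k' v' => ?_
    rw [ContinuousLinearMap.comp_apply, ContinuousLinearMap.adjoint_inner_right]
    simp [summandIncl_incl_tmul, inner_elem, hst]
  have h' := ContinuousLinearMap.adjoint_inner_right (summandIncl H s).toContinuousLinearMap x
    ((summandIncl H t).toContinuousLinearMap y)
  rw [← ContinuousLinearMap.comp_apply, h] at h'
  simpa using h'.symm

/-- `ℓ²(G, H) ⊗ ℓ²` is the Hilbert sum of copies of `H ⊗ ℓ²`. -/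
lemma isHilbertSum_summandIncl :
    IsHilbertSum ℂ (fun _ : G => HilbertTensor H) (summandIncl H) := by
  refine IsHilbertSum.mk orthogonalFamily_summandIncl ?_
  set M := (⨆ t : G, LinearMap.range (summandIncl H t).toLinearMap).topologicalClosure with hM
  have hel : ∀ (t : G) (ξ : H) (v : ell2), elem t ξ v ∈ M := fun t ξ v =>
    Submodule.le_topologicalClosure _ (Submodule.mem_iSup_of_mem t
      ⟨_, summandIncl_incl_tmul t ξ v⟩)
  have : CompleteSpace M := (Submodule.isClosed_topologicalClosure _).completeSpace_coe
  intro x _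
  have hx : x - M.starProjection x = 0 := eq_of_inner_elem fun t ξ v => by
    rw [inner_zero_right]
    exact Submodule.sub_starProjection_mem_orthogonal x _ (hel t ξ v)
  rw [sub_eq_zero] at hx
  rw [hx]
  exact Submodule.starProjection_apply_mem _ _

variable [CompleteSpace H]

/-- The operator `(x_t) ↦ ((1 ⊗ B_t) x_t)` on the Hilbert sum of copies of `H ⊗ ℓ²`. -/
def diagSum (H : Type*) [NormedAddCommGroup H] [InnerProductSpace ℂ H] [CompleteSpace H]
    (B : G → ell2 →L[ℂ] ell2) (hB : ∀ t, ‖B t‖ ≤ 1) :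
    lp (fun _ : G => HilbertTensor H) 2 →L[ℂ] lp (fun _ : G => HilbertTensor H) 2 :=
  lp.mapCLM 2 (fun t => opTensor (1 : H →L[ℂ] H) (B t)) zero_le_one
    (fun t => (norm_opTensor_le _ _).trans
      (mul_le_one₀ ContinuousLinearMap.norm_id_le (norm_nonneg _) (hB t)))

lemma diagSum_apply (B : G → ell2 →L[ℂ] ell2) (hB : ∀ t, ‖B t‖ ≤ 1)
    (x : lp (fun _ : G => HilbertTensor H) 2) (t : G) :
    diagSum H B hB x t = opTensor (1 : H →L[ℂ] H) (B t) (x t) := rfl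

/-- The operator `δ_t ξ ⊗ v ↦ δ_t ξ ⊗ B_t v` on `ℓ²(G, H) ⊗ ℓ²`. -/
def diagTensor (H : Type*) [NormedAddCommGroup H] [InnerProductSpace ℂ H] [CompleteSpace H]
    (B : G → ell2 →L[ℂ] ell2) (hB : ∀ t, ‖B t‖ ≤ 1) :
    HilbertTensor (lp (fun _ : G => H) 2) →L[ℂ] HilbertTensor (lp (fun _ : G => H) 2) :=
  (isHilbertSum_summandIncl (G := G) (H := H)).linearIsometryEquiv.symm.toContinuousLinearEquiv ∘L
    diagSum H B hB ∘L
    (isHilbertSum_summandIncl (G := G) (H := H)).linearIsometryEquiv.toContinuousLinearEquiv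

lemma diagTensor_elem (B : G → ell2 →L[ℂ] ell2) (hB : ∀ t, ‖B t‖ ≤ 1) (t : G) (ξ : H) (v : ell2) :
    diagTensor H B hB (elem t ξ v) = elem t ξ (B t v) := by
  set U := (isHilbertSum_summandIncl (G := G) (H := H)).linearIsometryEquiv with hU
  have h1 : ∀ v, U.symm (lp.single 2 t (HilbertTensor.incl H (ξ ⊗ₜ v))) = elem t ξ v := fun v => by
    rw [hU, IsHilbertSum.linearIsometryEquiv_symm_apply_single, summandIncl_incl_tmul]
  have h2 : U (elem t ξ v) = lp.single 2 t (HilbertTensor.incl H (ξ ⊗ₜ v)) := by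
    rw [← h1, LinearIsometryEquiv.apply_symm_apply]
  rw [← h1 (B t v)]
  change U.symm (diagSum H B hB (U (elem t ξ v))) = _
  rw [h2]
  congr 1
  ext s
  rw [diagSum_apply]
  rcases eq_or_ne s t with rfl | hs
  · simp [opTensor_incl_tmul]
  · simp [hs]

lemma norm_diagTensor (B : G → ell2 →L[ℂ] ell2) (hB : ∀ t, ‖B t‖ ≤ 1)
    (v : HilbertTensor (lp (fun _ : G => H) 2)) :
    ‖diagTensor H B hB v‖ = ‖diagSum H B hB
      ((isHilbertSum_summandIncl (G := G) (H := H)).linearIsometryEquiv v)‖ :=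
  (isHilbertSum_summandIncl (G := G) (H := H)).linearIsometryEquiv.symm.norm_map
    (diagSum H B hB ((isHilbertSum_summandIncl (G := G) (H := H)).linearIsometryEquiv v))

lemma hasSum_norm_sq {E : Type*} [NormedAddCommGroup E] (f : lp (fun _ : G => E) 2) :
    HasSum (fun t => ‖f t‖ ^ 2) (‖f‖ ^ 2) := by
  simpa using lp.hasSum_norm (p := 2) (by norm_num) f

lemma IsColumnContraction.diagTensor {I : Type*} {B : G → I → ell2 →L[ℂ] ell2}
    (hB : ∀ t, IsColumnContraction (B t)) :
    IsColumnContraction fun i => diagTensor H (fun t => B t i) fun t => (hB t).norm_le i := by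
  intro s v
  simp only [norm_diagTensor]
  rw [← LinearIsometryEquiv.norm_map
    (isHilbertSum_summandIncl (G := G) (H := H)).linearIsometryEquiv v]
  generalize (isHilbertSum_summandIncl (G := G) (H := H)).linearIsometryEquiv v = x
  refine hasSum_le (fun t => (hB t).one_tensor s (x t)) (hasSum_sum fun i _ => ?_)
    (hasSum_norm_sq x)
  have h := hasSum_norm_sq (diagSum H (fun t => B t i) (fun t => (hB t).norm_le i) x)
  simp only [diagSum_apply] at h
  exact h

end DirectSum

section Shift

lemma orthonormal_basisVec : Orthonormal ℂ basisVec := by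
  rw [orthonormal_iff_ite]
  intro i j
  rw [inner_basisVec, basisVec_apply]

lemma ell2_ext {F : Type*} [NormedAddCommGroup F] [NormedSpace ℂ F] {S T : ell2 →L[ℂ] F}
    (h : ∀ n, S (basisVec n) = T (basisVec n)) : S = T :=
  lp.ext_continuousLinearMap (by simp) fun n => by
    ext
    exact h n

lemma ell2_eq_of_inner {x y : ell2} (h : ∀ n, inner ℂ (basisVec n) x = inner ℂ (basisVec n) y) :
    x = y := by
  ext n
  simpa only [inner_basisVec] using h n

/-- `ℓ²` contains countably many pairwise orthogonal copies of itself. -/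
lemma exists_orthogonalFamily_ell2 (Γ : Type*) [Countable Γ] :
    ∃ W : Γ → ell2 →ₗᵢ[ℂ] ell2, OrthogonalFamily ℂ (fun _ : Γ => ell2) W := by
  obtain ⟨e, he⟩ := exists_injective_nat (Γ × ℕ)
  have ho : ∀ s : Γ, Orthonormal ℂ fun n => basisVec (e (s, n)) := fun s =>
    orthonormal_basisVec.comp _ fun m n h => (Prod.ext_iff.1 (he h)).2
  have hW : ∀ s n, (ho s).orthogonalFamily.linearIsometry (basisVec n) = basisVec (e (s, n)) :=
    fun s n => by
      rw [basisVec, OrthogonalFamily.linearIsometry_apply_single]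
      simp
  refine ⟨fun s => (ho s).orthogonalFamily.linearIsometry, fun s t hst x y => ?_⟩
  have h : (ho s).orthogonalFamily.linearIsometry.toContinuousLinearMap.adjoint ∘L
      (ho t).orthogonalFamily.linearIsometry.toContinuousLinearMap = 0 := by
    refine ell2_ext fun n => ell2_eq_of_inner fun m => ?_
    rw [ContinuousLinearMap.comp_apply, ContinuousLinearMap.adjoint_inner_right,
      LinearIsometry.coe_toContinuousLinearMap, LinearIsometry.coe_toContinuousLinearMap, hW, hW,
      orthonormal_basisVec.2 fun h => hst (Prod.ext_iff.1 (he h)).1]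
    simp
  have h' := ContinuousLinearMap.adjoint_inner_right
    (ho s).orthogonalFamily.linearIsometry.toContinuousLinearMap x
    ((ho t).orthogonalFamily.linearIsometry.toContinuousLinearMap y)
  rw [← ContinuousLinearMap.comp_apply, h] at h'
  simpa using h'.symm

variable {Γ : Type*} [Group Γ] [DecidableEq Γ] {W : Γ → ell2 →ₗᵢ[ℂ] ell2}
  (hW : OrthogonalFamily ℂ (fun _ : Γ => ell2) W)

lemma linearIsometry_adjoint_apply (w : ell2) (s : Γ) :
    hW.linearIsometry.toContinuousLinearMap.adjoint w s = (W s).toContinuousLinearMap.adjoint w := by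
  refine ext_inner_left ℂ fun v => ?_
  have h := lp.inner_single_left (𝕜 := ℂ) (G := fun _ : Γ => ell2) s v
    (hW.linearIsometry.toContinuousLinearMap.adjoint w)
  rw [ContinuousLinearMap.adjoint_inner_right, LinearIsometry.coe_toContinuousLinearMap,
    OrthogonalFamily.linearIsometry_apply_single] at h
  rw [ContinuousLinearMap.adjoint_inner_right, LinearIsometry.coe_toContinuousLinearMap]
  exact h.symm

lemma adjoint_apply_eq_ite (hW : OrthogonalFamily ℂ (fun _ : Γ => ell2) W) (s t : Γ) (v : ell2) :
    (W s).toContinuousLinearMap.adjoint (W t v) = if s = t then v else 0 := by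
  refine ext_inner_left ℂ fun w => ?_
  rw [ContinuousLinearMap.adjoint_inner_right]
  split_ifs with h
  · subst h
    simp
  · simpa using hW h w v

lemma isColumnContraction_adjoint (hW : OrthogonalFamily ℂ (fun _ : Γ => ell2) W) (γ : Γ) :
    IsColumnContraction fun r => (W (γ * r)).toContinuousLinearMap.adjoint := by
  intro s v
  have h1 : ‖hW.linearIsometry.toContinuousLinearMap.adjoint v‖ ≤ ‖v‖ := by
    have h := ContinuousLinearMap.le_opNorm hW.linearIsometry.toContinuousLinearMap.adjoint v
    rw [LinearIsometryEquiv.norm_map] at h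
    exact h.trans (mul_le_of_le_one_left (norm_nonneg _)
      (LinearIsometry.norm_toContinuousLinearMap_le _))
  have h2 := sum_le_hasSum (s.map (Equiv.mulLeft γ).toEmbedding) (fun _ _ => by positivity)
    (hasSum_norm_sq (hW.linearIsometry.toContinuousLinearMap.adjoint v))
  rw [Finset.sum_map] at h2
  simp only [linearIsometry_adjoint_apply] at h2
  exact h2.trans (by gcongr)

/-- The operator `∑ₛ W_{gs} b Wₛ*`, a copy of `λ_g ⊗ b` on `ℓ²(Γ) ⊗ ℓ²`. -/
def shift (g : Γ) (b : ell2 →L[ℂ] ell2) : ell2 →L[ℂ] ell2 :=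
  hW.linearIsometry.toContinuousLinearMap ∘L lam ell2 g ∘L
    lp.mapCLM 2 (fun _ : Γ => b) (norm_nonneg b) (fun _ => le_rfl) ∘L
    hW.linearIsometry.toContinuousLinearMap.adjoint

lemma inner_shift (g : Γ) (b : ell2 →L[ℂ] ell2) (v w : ell2) :
    inner ℂ w (shift hW g b v) =
      ∑' s, inner ℂ ((W (g * s)).toContinuousLinearMap.adjoint w)
        (b ((W s).toContinuousLinearMap.adjoint v)) := by
  rw [shift, ContinuousLinearMap.comp_apply, ← ContinuousLinearMap.adjoint_inner_left,
    lp.inner_eq_tsum, ← (Equiv.mulLeft g).tsum_eq]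
  refine tsum_congr fun s => ?_
  rw [linearIsometry_adjoint_apply, ContinuousLinearMap.comp_apply, lam_apply,
    ContinuousLinearMap.comp_apply, lp.mapCLM_apply_coe, linearIsometry_adjoint_apply]
  simp

lemma shift_apply (g s : Γ) (b : ell2 →L[ℂ] ell2) (v : ell2) :
    shift hW g b (W s v) = W (g * s) (b v) := by
  refine ext_inner_left ℂ fun w => ?_
  rw [inner_shift, tsum_eq_single s fun t ht => by rw [adjoint_apply_eq_ite hW, if_neg ht]; simp,
    adjoint_apply_eq_ite hW, if_pos rfl, ContinuousLinearMap.adjoint_inner_left]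
  simp

end Shift

section Subgroup

variable {G : Type*} [Group G]

/-- A map `q : G → Γ` onto a subgroup with `q(gt) = g q(t)` for `g ∈ Γ`. -/
lemma exists_equivariant_retraction (Γ : Subgroup G) :
    ∃ q : G → Γ, ∀ (g : Γ) (t : G), q (g * t) = g * q t := by
  have h : ∀ t : G, t * (Quotient.out (Quotient.mk (QuotientGroup.rightRel Γ) t))⁻¹ ∈ Γ :=
    fun t => QuotientGroup.rightRel_apply.1
      (Quotient.exact (Quotient.out_eq (Quotient.mk (QuotientGroup.rightRel Γ) t)))
  refine ⟨fun t => ⟨_, h t⟩, fun g t => Subtype.ext ?_⟩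
  have hq : Quotient.mk (QuotientGroup.rightRel Γ) (g * t) = Quotient.mk _ t :=
    Quotient.sound (QuotientGroup.rightRel_apply.2 (by simp))
  simp only [hq, Subgroup.coe_mul, mul_assoc]

lemma countable_subgroup_closure {s : Set G} (hs : s.Countable) :
    Countable (Subgroup.closure s) := by
  have : Countable s := hs.to_subtype
  have : Countable (FreeGroup s) :=
    inferInstanceAs (Countable (Quot (FreeGroup.Red.Step (α := s))))
  rw [FreeGroup.closure_eq_range]
  exact (FreeGroup.lift ((↑) : s → G)).rangeRestrict_surjective.countable

end Subgroup

section Coefficients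

variable {G : Type*} [Group G] [DecidableEq G] {H : Type*} [NormedAddCommGroup H]
  [InnerProductSpace ℂ H] [CompleteSpace H] {A : StarSubalgebra ℂ (H →L[ℂ] H)}
  [IsClosed (A : Set (H →L[ℂ] H))] (α : G →* (A ≃⋆ₐ[ℂ] A))

lemma piRep_mul_lam_single (a : A) (g t : G) (ξ : H) :
    (piRep α a * lam H g) (lp.single 2 t ξ) =
      lp.single 2 (g * t) (((α (g * t)⁻¹ a : A) : H →L[ℂ] H) ξ) := by
  ext s
  change ((α s⁻¹ a : A) : H →L[ℂ] H) ((lp.single 2 t ξ : lp (fun _ : G => H) 2) (g⁻¹ * s)) = _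
  rcases eq_or_ne s (g * t) with rfl | hs
  · simp
  · have h : g⁻¹ * s ≠ t := fun h => hs (by rw [← h, mul_inv_cancel_left])
    simp [hs, h]

lemma mem_reducedCrossedProduct_iff (x : lp (fun _ : G => H) 2 →L[ℂ] lp (fun _ : G => H) 2) :
    x ∈ reducedCrossedProduct α ↔ x ∈ closure (Submodule.span ℂ
      {x | ∃ (a : A) (r : G), x = piRep α a * lam H r} : Set _) := by
  change x ∈ closure (integratedForm α '' l1 G A) ↔ _
  rw [closure_image_integratedForm, StarSubalgebra.topologicalClosure_coe]
  rfl

lemma piRep_mul_lam_mem (a : A) (g : G) : piRep α a * lam H g ∈ reducedCrossedProduct α :=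
  (mem_reducedCrossedProduct_iff α _).2 (subset_closure (Submodule.subset_span ⟨a, g, rfl⟩))

/-- The map `a ↦ π(a) λ_g` from `A` to `A ⋊ G`. -/
def fiberIncl (g : G) : A →L[ℂ] reducedCrossedProduct α :=
  LinearMap.mkContinuous
    { toFun := fun a => ⟨piRep α a * lam H g, piRep_mul_lam_mem α a g⟩
      map_add' := fun a b => Subtype.ext (by simp [piRep_add, add_mul])
      map_smul' := fun z a => Subtype.ext (by simp [piRep_smul]) } 1 fun a => by
    change ‖piRep α a * lam H g‖ ≤ _
    refine (norm_mul_le _ _).trans ?_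
    rw [one_mul]
    exact (mul_le_mul (norm_piRep_le α a) (norm_lam_le g) (norm_nonneg _)
      (norm_nonneg _)).trans_eq (mul_one _)

@[simp] lemma coe_fiberIncl (g : G) (a : A) :
    (fiberIncl α g a : lp (fun _ : G => H) 2 →L[ℂ] _) = piRep α a * lam H g := rfl

lemma norm_fiberIncl_le (g : G) : ‖fiberIncl α g‖ ≤ 1 :=
  LinearMap.mkContinuous_norm_le _ zero_le_one _

/-- The span of the elements `π(a) λ_g` in `A ⋊ G`. -/
def fiberSpan : Submodule ℂ (reducedCrossedProduct α) :=
  Submodule.span ℂ {x | ∃ (g : G) (a : A), x = fiberIncl α g a}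

lemma dense_fiberSpan : Dense (fiberSpan α : Set (reducedCrossedProduct α)) := by
  intro x
  have hx := (mem_reducedCrossedProduct_iff α x).1 x.2
  rw [Metric.mem_closure_iff] at hx ⊢
  intro ε hε
  obtain ⟨y, hy, hxy⟩ := hx ε hε
  have hy' : y ∈ reducedCrossedProduct α :=
    (mem_reducedCrossedProduct_iff α y).2 (subset_closure hy)
  refine ⟨⟨y, hy'⟩, ?_, hxy⟩
  have hle : Submodule.span ℂ {x | ∃ (a : A) (r : G), x = piRep α a * lam H r} ≤
      (fiberSpan α).map (reducedCrossedProduct α).toSubalgebra.val.toLinearMap := by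
    refine Submodule.span_le.2 ?_
    rintro _ ⟨a, g, rfl⟩
    exact ⟨fiberIncl α g a, Submodule.subset_span ⟨g, a, rfl⟩, rfl⟩
  obtain ⟨z, hz, hzy⟩ := hle hy
  have : (⟨y, hy'⟩ : reducedCrossedProduct α) = z := Subtype.ext hzy.symm
  rw [this]
  exact hz

/-- The `(1, g⁻¹)` entry of an operator on `ℓ²(G, H)`. -/
def entry (H : Type*) [NormedAddCommGroup H] [InnerProductSpace ℂ H] (g : G) :
    (lp (fun _ : G => H) 2 →L[ℂ] lp (fun _ : G => H) 2) →L[ℂ] (H →L[ℂ] H) :=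
  LinearMap.mkContinuous
    { toFun := fun X => lp.evalCLM ℂ (fun _ : G => H) 2 1 ∘L X ∘L
        (singleIsometry H g⁻¹).toContinuousLinearMap
      map_add' := fun X Y => by ext; simp
      map_smul' := fun z X => by ext; simp } 1 fun X => by
    refine ContinuousLinearMap.opNorm_le_bound _ (by positivity) fun ξ => ?_
    change ‖X (singleIsometry H g⁻¹ ξ) 1‖ ≤ _
    rw [one_mul, ← (singleIsometry H g⁻¹).norm_map ξ]
    exact (lp.norm_apply_le_norm (by norm_num) _ _).trans (X.le_opNorm _)

lemma entry_apply (g : G) (X : lp (fun _ : G => H) 2 →L[ℂ] lp (fun _ : G => H) 2) (ξ : H) :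
    entry H g X ξ = X (lp.single 2 g⁻¹ ξ) 1 := rfl

lemma entry_piRep_mul_lam (g h : G) (a : A) :
    entry H g (piRep α a * lam H h) = if h = g then (a : H →L[ℂ] H) else 0 := by
  ext ξ
  rw [entry_apply, piRep_mul_lam_single]
  split_ifs with hg
  · subst hg; simp
  · have : (1 : G) ≠ h * g⁻¹ := fun h1 => hg (mul_inv_eq_one.1 h1.symm)
    simp [this]

lemma entry_mem (g : G) (x : reducedCrossedProduct α) :
    entry H g (x : lp (fun _ : G => H) 2 →L[ℂ] _) ∈ A := by
  have hA : IsClosed (A : Set (H →L[ℂ] H)) := inferInstance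
  have hc : IsClosed {x : lp (fun _ : G => H) 2 →L[ℂ] lp (fun _ : G => H) 2 | entry H g x ∈ A} :=
    hA.preimage (entry H g).continuous
  refine closure_minimal (fun y hy => ?_) hc ((mem_reducedCrossedProduct_iff α x).1 x.2)
  refine Submodule.span_induction ?_ ?_ ?_ ?_ hy
  · rintro _ ⟨a, h, rfl⟩
    change entry H g (piRep α a * lam H h) ∈ A
    rw [entry_piRep_mul_lam]
    split_ifs
    · exact a.2
    · exact zero_mem A
  · change entry H g 0 ∈ A
    rw [map_zero]; exact zero_mem A
  · intro x y _ _ hx hy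
    change entry H g (x + y) ∈ A
    rw [map_add]; exact add_mem hx hy
  · intro z x _ hx
    change entry H g (z • x) ∈ A
    rw [map_smul]; exact A.smul_mem hx z

/-- The Fourier coefficient `A ⋊ G → A` at `g`. -/
def coeff (g : G) : reducedCrossedProduct α →L[ℂ] A :=
  LinearMap.mkContinuous
    { toFun := fun x => ⟨entry H g (x : lp (fun _ : G => H) 2 →L[ℂ] _), entry_mem α g x⟩
      map_add' := fun x y => Subtype.ext (by simp)
      map_smul' := fun z x => Subtype.ext (by simp) } 1 fun x => by
    change ‖entry H g (x : lp (fun _ : G => H) 2 →L[ℂ] lp (fun _ : G => H) 2)‖ ≤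
      1 * ‖(x : lp (fun _ : G => H) 2 →L[ℂ] lp (fun _ : G => H) 2)‖
    exact ContinuousLinearMap.le_of_opNorm_le _ (LinearMap.mkContinuous_norm_le _ zero_le_one _) _

lemma norm_coeff_le (g : G) : ‖coeff α g‖ ≤ 1 :=
  LinearMap.mkContinuous_norm_le _ zero_le_one _

lemma coe_coeff (g : G) (x : reducedCrossedProduct α) :
    (coeff α g x : H →L[ℂ] H) = entry H g (x : lp (fun _ : G => H) 2 →L[ℂ] _) := rfl

lemma coeff_fiberIncl (g h : G) (a : A) :
    coeff α g (fiberIncl α h a) = if h = g then a else 0 := by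
  refine Subtype.ext ?_
  rw [coe_coeff, coe_fiberIncl, entry_piRep_mul_lam]
  split_ifs <;> rfl

lemma coeff_integratedForm {f : G → A} (hf : f ∈ l1 G A) (g : G) :
    coeff α g ⟨integratedForm α f, integratedForm_mem α hf⟩ = f g := by
  refine Subtype.ext ?_
  rw [coe_coeff]
  have h := (entry H g).hasSum (summable_integratedForm α hf).hasSum
  refine h.unique ?_
  simp only [entry_piRep_mul_lam]
  convert! hasSum_ite_eq g ((f g : A) : H →L[ℂ] H) using 1
  ext s
  split_ifs with hs
  · rw [hs]
  · rfl

lemma finite_support_coeff {x : reducedCrossedProduct α} (hx : x ∈ fiberSpan α) :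
    {g | coeff α g x ≠ 0}.Finite := by
  refine Submodule.span_induction ?_ ?_ ?_ ?_ hx
  · rintro _ ⟨h, a, rfl⟩
    refine (Set.finite_singleton h).subset fun g hg => ?_
    by_contra hne
    exact hg (by rw [coeff_fiberIncl, if_neg fun h' => hne h'.symm])
  · simp
  · intro x y _ _ hx hy
    refine (hx.union hy).subset fun g hg => ?_
    by_contra hne
    simp only [Set.mem_union, Set.mem_ofPred_eq, not_or, not_not] at hne
    exact hg (by rw [map_add, hne.1, hne.2, add_zero])
  · intro z x _ hx
    refine hx.subset fun g hg h => hg (by rw [map_smul, h, smul_zero])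

attribute [irreducible] fiberIncl coeff

end Coefficients

section Nets

/-- Approximation on finite sets gives a net converging pointwise. -/
lemma exists_net {β Y : Type*} [PseudoMetricSpace Y] (f : β → Y → Y) (P : β → Prop)
    (h : ∀ (X : Finset Y) (ε : ℝ), 0 < ε → ∃ b, P b ∧ ∀ x ∈ X, dist (f b x) x < ε) :
    ∃ b : Finset Y × ℕ → β, (∀ i, P (b i)) ∧
      ∀ x, Tendsto (fun i => f (b i) x) atTop (𝓝 x) := by
  have h' : ∀ i : Finset Y × ℕ, ∃ b, P b ∧ ∀ x ∈ i.1, dist (f b x) x < 1 / ((i.2 : ℝ) + 1) :=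
    fun i => h i.1 (1 / ((i.2 : ℝ) + 1)) Nat.one_div_pos_of_nat
  choose b hP hb using h'
  refine ⟨b, hP, fun x => ?_⟩
  rw [Metric.tendsto_nhds]
  intro ε hε
  obtain ⟨n, hn⟩ := exists_nat_one_div_lt hε
  filter_upwards [eventually_ge_atTop (({x}, n) : Finset Y × ℕ)] with i hi
  have h1 : n ≤ i.2 := hi.2
  have h2 : x ∈ i.1 := hi.1 (Finset.mem_singleton_self x)
  refine (hb i x h2).trans (lt_of_le_of_lt ?_ hn)
  exact Nat.one_div_le_one_div h1

lemma exists_dist_lt_of_mem_closure_pi {X Y : Type*} [Fintype X] [PseudoMetricSpace Y]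
    {M : Set (X → Y)} {p : X → Y} (hp : p ∈ closure M) {ε : ℝ} (hε : 0 < ε) :
    ∃ m ∈ M, ∀ x, dist (m x) (p x) < ε := by
  obtain ⟨m, hm, hd⟩ := Metric.mem_closure_iff.1 hp ε hε
  refine ⟨m, hm, fun x => ?_⟩
  rw [dist_comm]
  exact (dist_pi_lt_iff hε).1 hd x

variable {K : Type*} [NormedAddCommGroup K] [InnerProductSpace ℂ K] [CompleteSpace K]
  {C : StarSubalgebra ℂ (K →L[ℂ] K)}

/-- `T ↦ ((T ⊗ id) x)ₓ` as a linear map on `CB(C)`. -/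
def amplifyEval (X : Finset (minTensor C)) : CBMap C →ₗ[ℂ] (X → minTensor C) where
  toFun T x := amplify (T : C →L[ℂ] C) x
  map_add' S T := by ext x : 1; rw [amplify_add]; rfl
  map_smul' z T := by ext x : 1; rw [amplify_smul]; rfl

variable (C) in
/-- The completely bounded maps of finite rank. -/
def finiteRankCB : Submodule ℂ (CBMap C) where
  carrier := {T | FiniteDimensional ℂ (LinearMap.range (T : C →L[ℂ] C).toLinearMap)}
  add_mem' := by
    intro S T hS hT
    have hS' : FiniteDimensional ℂ (LinearMap.range (S : C →L[ℂ] C).toLinearMap) := hS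
    have hT' : FiniteDimensional ℂ (LinearMap.range (T : C →L[ℂ] C).toLinearMap) := hT
    refine Submodule.finiteDimensional_of_le (S₂ := LinearMap.range (S : C →L[ℂ] C).toLinearMap ⊔
      LinearMap.range (T : C →L[ℂ] C).toLinearMap) ?_
    rintro _ ⟨x, rfl⟩
    exact Submodule.add_mem_sup ⟨x, rfl⟩ ⟨x, rfl⟩
  zero_mem' := by
    refine Submodule.finiteDimensional_of_le (S₂ := (⊥ : Submodule ℂ C)) ?_
    rintro _ ⟨x, rfl⟩
    simp
  smul_mem' := by
    intro z T hT
    have hT' : FiniteDimensional ℂ (LinearMap.range (T : C →L[ℂ] C).toLinearMap) := hT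
    refine Submodule.finiteDimensional_of_le
      (S₂ := LinearMap.range (T : C →L[ℂ] C).toLinearMap) ?_
    rintro _ ⟨x, rfl⟩
    exact Submodule.smul_mem _ z ⟨x, rfl⟩

/-- A weak limit of a net in a subspace lies in the norm closure of the subspace. -/
lemma mem_closure_of_tendsto_dual {E : Type*} [NormedAddCommGroup E] [NormedSpace ℂ E]
    (M : Submodule ℂ E) {ι : Type*} {l : Filter ι} [l.NeBot] {m : ι → E} {p : E}
    (hm : ∀ i, m i ∈ M) (h : ∀ f : E →L[ℂ] ℂ, Tendsto (fun i => f (m i)) l (𝓝 (f p))) :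
    p ∈ closure (M : Set E) := by
  by_contra hp
  obtain ⟨f, u, hu, hup⟩ := RCLike.geometric_hahn_banach_closed_point (𝕜 := ℂ)
    (M.restrictScalars ℝ).convex.closure isClosed_closure hp
  refine hup.not_ge (le_of_tendsto ((RCLike.continuous_re.tendsto _).comp (h f))
    (Filter.Eventually.of_forall fun i => ?_))
  exact (hu _ (subset_closure (hm i))).le

lemma amplifyEval_apply (X : Finset (minTensor C)) (T : CBMap C) (x : X) :
    amplifyEval X T x = amplify (T : C →L[ℂ] C) x := rfl

lemma amplifyEval_id (X : Finset (minTensor C)) :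
    amplifyEval X (CBMap.id C) = fun x : X => (x : minTensor C) := by
  ext x : 1
  change amplify (ContinuousLinearMap.id ℂ C) _ = _
  rw [amplify_id]
  rfl

lemma dual_amplifyEval [DecidableEq (minTensor C)] (X : Finset (minTensor C))
    (f : (X → minTensor C) →L[ℂ] ℂ) (S : CBMap C) : f (amplifyEval X S) = ∑ x : X,
      omega (x : minTensor C) (f ∘L ContinuousLinearMap.single ℂ (fun _ : X => minTensor C) x)
        S := by
  conv_lhs => rw [← Finset.univ_sum_single (amplifyEval X S), map_sum]
  rfl

/-- Weak approximation of the identity by completely bounded maps of finite rank puts it in the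
point-norm closure of these maps. -/
lemma mem_closure_amplifyEval {ι : Type*} [Preorder ι] [IsDirected ι (· ≤ ·)] [Nonempty ι]
    (T : ι → CBMap C) (hT : ∀ i, T i ∈ finiteRankCB C)
    (h : ∀ x ψ, Tendsto (fun i => omega x ψ (T i)) atTop (𝓝 (omega x ψ (CBMap.id C))))
    (X : Finset (minTensor C)) :
    amplifyEval X (CBMap.id C) ∈
      closure ((finiteRankCB C).map (amplifyEval X) : Set (X → minTensor C)) := by
  classical
  refine mem_closure_of_tendsto_dual _ (l := atTop) (m := fun i => amplifyEval X (T i))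
    (fun i => ⟨T i, hT i, rfl⟩) fun f => ?_
  simp only [dual_amplifyEval]
  exact tendsto_finsetSum _ fun x _ => h _ _

set_option maxHeartbeats 400000 in
/-- Weak approximation of the identity by completely bounded maps of finite rank can be improved to
norm approximation. -/
lemma exists_finiteRankCB_dist_lt {ι : Type*} [Preorder ι] [IsDirected ι (· ≤ ·)] [Nonempty ι]
    (T : ι → CBMap C) (hT : ∀ i, T i ∈ finiteRankCB C)
    (h : ∀ x ψ, Tendsto (fun i => omega x ψ (T i)) atTop (𝓝 (omega x ψ (CBMap.id C))))
    (X : Finset (minTensor C)) (ε : ℝ) (hε : 0 < ε) :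
    ∃ S ∈ finiteRankCB C, ∀ x ∈ X, dist (amplify (S : C →L[ℂ] C) x) x < ε := by
  obtain ⟨m, hm, hd⟩ := exists_dist_lt_of_mem_closure_pi (mem_closure_amplifyEval T hT h X) hε
  obtain ⟨S, hS, hSm⟩ := Submodule.mem_map.1 hm
  refine ⟨S, hS, fun x hx => ?_⟩
  have h1 := hd ⟨x, hx⟩
  rw [← hSm, amplifyEval_id, amplifyEval_apply] at h1
  dsimp only at h1
  exact h1

end Nets

section Multipliers

variable {G : Type*} [Group G] [DecidableEq G] {H : Type*} [NormedAddCommGroup H]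
  [InnerProductSpace ℂ H] [CompleteSpace H] {A : StarSubalgebra ℂ (H →L[ℂ] H)}
  [IsClosed (A : Set (H →L[ℂ] H))] {α : G →* (A ≃⋆ₐ[ℂ] A)}

lemma integratedForm_eq_sum {f : G → A} {s : Finset G} (hf : ∀ r ∉ s, f r = 0) :
    integratedForm α f = ∑ r ∈ s, piRep α (f r) * lam H r := by
  have hp : piRep α (0 : A) = 0 := by simpa using piRep_smul α 0 (0 : A)
  simp only [integratedForm]
  exact tsum_eq_sum fun r hr => by rw [hf r hr, hp, zero_mul]

lemma integratedForm_single (g : G) (a : A) :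
    integratedForm α (Pi.single g a) = piRep α a * lam H g := by
  rw [integratedForm_eq_sum (s := {g}) fun r hr => by rw [Pi.single_eq_of_ne (by simpa using hr)],
    Finset.sum_singleton, Pi.single_eq_same]

lemma single_mem_l1 (g : G) (a : A) : (Pi.single g a : G → A) ∈ l1 G A :=
  summable_of_ne_finset_zero (s := {g}) fun s hs => by
    rw [Pi.single_eq_of_ne (by simpa using hs), norm_zero]

lemma fiberIncl_eq_integratedForm (g : G) (a : A) :
    fiberIncl α g a = ⟨integratedForm α (Pi.single g a),
      integratedForm_mem α (single_mem_l1 g a)⟩ :=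
  Subtype.ext ((coe_fiberIncl α g a).trans (integratedForm_single g a).symm)

lemma IsMultiplierMap.apply_fiberIncl {F : G → CBMap A} {S : CBMap (reducedCrossedProduct α)}
    (hS : IsMultiplierMap α F S) (g : G) (a : A) :
    (S : reducedCrossedProduct α →L[ℂ] reducedCrossedProduct α) (fiberIncl α g a) =
      fiberIncl α g ((F g : A →L[ℂ] A) a) := by
  have h2 : (fun r => (F r : A →L[ℂ] A) ((Pi.single g a : G → A) r)) =
      Pi.single g ((F g : A →L[ℂ] A) a) := by
    ext r : 1
    rcases eq_or_ne r g with rfl | hr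
    · rw [Pi.single_eq_same, Pi.single_eq_same]
    · rw [Pi.single_eq_of_ne hr, Pi.single_eq_of_ne hr, map_zero]
  have h3 := ((hS _ (single_mem_l1 g a)).trans (congrArg (integratedForm α) h2)).trans
    (integratedForm_single g _)
  have h4 := Subtype.ext (h3.trans (coe_fiberIncl α g _).symm)
  exact (congrArg (S : reducedCrossedProduct α →L[ℂ] reducedCrossedProduct α)
    (fiberIncl_eq_integratedForm g a)).trans h4

/-- `S_F` has finite rank when `F` is finitely supported with values of finite rank. -/
lemma HerzSchurMultiplier.toCBMap_mem_finiteRankCB (F : HerzSchurMultiplier α)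
    (hs : {r : G | F.1 r ≠ 0}.Finite)
    (hr : ∀ r, FiniteDimensional ℂ (LinearMap.range (F.1 r : A →L[ℂ] A).toLinearMap)) :
    F.toCBMap ∈ finiteRankCB (reducedCrossedProduct α) := by
  have : Finite {r : G | F.1 r ≠ 0} := hs
  let V : Submodule ℂ (reducedCrossedProduct α) := ⨆ r : {r : G | F.1 r ≠ 0},
    (LinearMap.range (F.1 r : A →L[ℂ] A).toLinearMap).map (fiberIncl α (r : G)).toLinearMap
  have hV : FiniteDimensional ℂ V := Submodule.finiteDimensional_iSup _
  have hle : fiberSpan α ≤ V.comap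
      (F.toCBMap : reducedCrossedProduct α →L[ℂ] reducedCrossedProduct α).toLinearMap := by
    refine Submodule.span_le.2 ?_
    rintro _ ⟨g, a, rfl⟩
    change (F.toCBMap : reducedCrossedProduct α →L[ℂ] reducedCrossedProduct α)
      (fiberIncl α g a) ∈ V
    rw [F.isMultiplierMap_toCBMap.apply_fiberIncl]
    by_cases hg : F.1 g = 0
    · rw [hg]
      simp
    · exact Submodule.mem_iSup_of_mem ⟨g, hg⟩ ⟨_, ⟨a, rfl⟩, rfl⟩
  refine Submodule.finiteDimensional_of_le (S₂ := V) ?_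
  rintro _ ⟨x, rfl⟩
  have hc : IsClosed {x | (F.toCBMap : reducedCrossedProduct α →L[ℂ] reducedCrossedProduct α) x ∈
      V} := V.closed_of_finiteDimensional.preimage (ContinuousLinearMap.continuous _)
  exact closure_minimal (fun y hy => hle hy) hc (dense_fiberSpan α x)

lemma finiteDimensional_range_sum_smulRight {E F : Type*} [NormedAddCommGroup E] [NormedSpace ℂ E]
    [NormedAddCommGroup F] [NormedSpace ℂ F] {n : ℕ} (φ : Fin n → E →L[ℂ] ℂ) (c : Fin n → F) :
    FiniteDimensional ℂ (LinearMap.range (∑ k, (φ k).smulRight (c k)).toLinearMap) := by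
  have : FiniteDimensional ℂ (Submodule.span ℂ (Set.range c)) :=
    FiniteDimensional.span_of_finite ℂ (Set.finite_range c)
  refine Submodule.finiteDimensional_of_le (S₂ := Submodule.span ℂ (Set.range c)) ?_
  rintro _ ⟨x, rfl⟩
  simp only [ContinuousLinearMap.coe_coe, sum_apply, ContinuousLinearMap.smulRight_apply]
  exact Submodule.sum_mem _ fun k _ => Submodule.smul_mem _ _ (Submodule.subset_span ⟨k, rfl⟩)

/-- A finite rank map on `A ⋊ G` with range in the span of the `π(a) λ_g` gives a finitely
supported Herz–Schur multiplier. -/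
lemma exists_herzSchurMultiplier {n : ℕ} (φ : Fin n → reducedCrossedProduct α →L[ℂ] ℂ)
    (d : Fin n → reducedCrossedProduct α) (hd : ∀ k, d k ∈ fiberSpan α) :
    ∃ F : HerzSchurMultiplier α, {r : G | F.1 r ≠ 0}.Finite ∧
      (∀ r, FiniteDimensional ℂ (LinearMap.range (F.1 r : A →L[ℂ] A).toLinearMap)) ∧
      ∀ g a, (F.1 g : A →L[ℂ] A) a =
        coeff α g ((∑ k, (φ k).smulRight (d k)) (fiberIncl α g a)) := by
  let T : G → A →L[ℂ] A := fun r => ∑ k, (φ k ∘L fiberIncl α r).smulRight (coeff α r (d k))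
  have hT : ∀ r, CBBound (T r) (∑ k, ‖φ k‖ * ‖d k‖) := fun r => by
    refine (CBBound.sum Finset.univ fun k _ => CBBound.smulRight _ _).mono ?_
    gcongr with k
    · refine (ContinuousLinearMap.opNorm_comp_le _ _).trans ?_
      exact mul_le_of_le_one_right (norm_nonneg _) (norm_fiberIncl_le α r)
    · exact (ContinuousLinearMap.le_of_opNorm_le _ (norm_coeff_le α r) _).trans_eq (one_mul _)
  have hfin : (⋃ k, {g | coeff α g (d k) ≠ 0}).Finite :=
    Set.finite_iUnion fun k => finite_support_coeff α (hd k)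
  have hT0 : ∀ r ∉ hfin.toFinset, T r = 0 := fun r hr => by
    simp only [Set.Finite.mem_toFinset, Set.mem_iUnion, not_exists, Set.mem_ofPred_eq,
      not_not] at hr
    refine Finset.sum_eq_zero fun k _ => ?_
    rw [hr k]
    ext; simp
  have hTval : ∀ g a, T g a = coeff α g ((∑ k, (φ k).smulRight (d k)) (fiberIncl α g a)) := by
    intro g a
    simp [T, sum_apply]
  let S : reducedCrossedProduct α →L[ℂ] reducedCrossedProduct α := ∑ h ∈ hfin.toFinset,
    ∑ k, (φ k ∘L fiberIncl α h ∘L coeff α h).smulRight (fiberIncl α h (coeff α h (d k)))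
  have hS : ∀ x, S x = ∑ h ∈ hfin.toFinset, fiberIncl α h (T h (coeff α h x)) := by
    intro x
    simp [S, T, sum_apply]
  have hScb : S ∈ CBMap (reducedCrossedProduct α) :=
    ⟨_, CBBound.sum _ fun h _ => CBBound.sum _ fun k _ => CBBound.smulRight _ _⟩
  let F : G → CBMap A := fun r => ⟨T r, _, hT r⟩
  refine ⟨⟨F, ⟨_, hT⟩, ⟨S, hScb⟩, fun f hf => ?_⟩, ?_, fun r => ?_, hTval⟩
  · change (S _ : lp (fun _ : G => H) 2 →L[ℂ] _) = integratedForm α fun r => T r (f r)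
    rw [hS, integratedForm_eq_sum (f := fun r => T r (f r)) (s := hfin.toFinset)
      fun r hr => by rw [hT0 r hr, zero_apply],
      AddSubmonoidClass.coe_finsetSum]
    refine Finset.sum_congr rfl fun r _ => ?_
    rw [coe_fiberIncl]
    exact congrArg (fun a => piRep α (T r a) * lam H r) (coeff_integratedForm α hf r)
  · refine hfin.toFinset.finite_toSet.subset fun r hr => ?_
    by_contra hne
    exact hr (Subtype.ext (hT0 r hne))
  · exact finiteDimensional_range_sum_smulRight _ _

end Multipliers

section Absorption

variable {K : Type*} [NormedAddCommGroup K] [InnerProductSpace ℂ K] [CompleteSpace K]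

/-- `c ↦ c ⊗ b` as a bounded map. -/
def opTensorLeft (K : Type*) [NormedAddCommGroup K] [InnerProductSpace ℂ K] [CompleteSpace K]
    (b : ell2 →L[ℂ] ell2) :
    (K →L[ℂ] K) →L[ℂ] (HilbertTensor K →L[ℂ] HilbertTensor K) :=
  LinearMap.mkContinuous (opTensorBilin.flip b) ‖b‖ fun c =>
    (norm_opTensor_le c b).trans_eq (mul_comm _ _)

/-- The inclusion of `C` in `B(K)`. -/
def inclOp (C : StarSubalgebra ℂ (K →L[ℂ] K)) : C →L[ℂ] (K →L[ℂ] K) where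
  toFun c := c
  map_add' _ _ := rfl
  map_smul' _ _ := rfl
  cont := continuous_subtype_val

lemma continuous_toMinTensor_tmul (C : StarSubalgebra ℂ (K →L[ℂ] K)) (b : ell2 →L[ℂ] ell2) :
    Continuous fun c : C => toMinTensor C (c ⊗ₜ b) := by
  refine Continuous.subtype_mk (f := fun c : C => opTensorLeft K b c) ?_ _
  exact (opTensorLeft K b).continuous.comp continuous_subtype_val

variable {G : Type*} [Group G] [DecidableEq G] {H : Type*} [NormedAddCommGroup H]
  [InnerProductSpace ℂ H] [CompleteSpace H] {A : StarSubalgebra ℂ (H →L[ℂ] H)}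
  [IsClosed (A : Set (H →L[ℂ] H))] (α : G →* (A ≃⋆ₐ[ℂ] A))

lemma fiberIncl_ext {F : Type*} [NormedAddCommGroup F] [NormedSpace ℂ F]
    {S T : reducedCrossedProduct α →L[ℂ] F}
    (h : ∀ g a, S (fiberIncl α g a) = T (fiberIncl α g a)) : S = T :=
  ContinuousLinearMap.ext_on (dense_fiberSpan α) (by rintro _ ⟨g, a, rfl⟩; exact h g a)

/-- The span of the elements `π(a) λ_g ⊗ b` with `g ∈ T`. -/
def tensorSpan (T : Set G) : Submodule ℂ (minTensor (reducedCrossedProduct α)) :=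
  Submodule.span ℂ {x | ∃ g ∈ T, ∃ a b, x = toMinTensor _ (fiberIncl α g a ⊗ₜ b)}

lemma tensorSpan_mono {S T : Set G} (h : S ⊆ T) : tensorSpan α S ≤ tensorSpan α T :=
  Submodule.span_mono fun _ ⟨g, hg, hx⟩ => ⟨g, h hg, hx⟩

lemma toMinTensor_tmul_mem (c : reducedCrossedProduct α) (b : ell2 →L[ℂ] ell2) :
    toMinTensor _ (c ⊗ₜ b) ∈ (tensorSpan α Set.univ).topologicalClosure := by
  have hc : IsClosed {c : reducedCrossedProduct α |
      toMinTensor _ (c ⊗ₜ b) ∈ (tensorSpan α Set.univ).topologicalClosure} :=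
    (Submodule.isClosed_topologicalClosure _).preimage (continuous_toMinTensor_tmul _ b)
  refine closure_minimal (fun c hc => ?_) hc (dense_fiberSpan α c)
  refine Submodule.le_topologicalClosure _ ?_
  have hle : fiberSpan α ≤ (tensorSpan α Set.univ).comap
      (toMinTensor _ ∘ₗ (TensorProduct.mk ℂ (reducedCrossedProduct α) _).flip b) :=
    Submodule.span_le.2 (by
      rintro _ ⟨g, a, rfl⟩
      exact Submodule.subset_span ⟨g, Set.mem_univ g, a, b, rfl⟩)
  exact hle hc

lemma dense_tensorSpan (x : minTensor (reducedCrossedProduct α)) :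
    x ∈ closure (tensorSpan α Set.univ : Set (minTensor (reducedCrossedProduct α))) := by
  have h : ∀ u, toMinTensor _ u ∈ (tensorSpan α Set.univ).topologicalClosure := fun u => by
    induction u with
    | zero => rw [map_zero]; exact Submodule.zero_mem _
    | add u v hu hv => rw [map_add]; exact Submodule.add_mem _ hu hv
    | tmul c b => exact toMinTensor_tmul_mem α c b
  exact closure_minimal (Set.range_subset_iff.2 h) (Submodule.isClosed_topologicalClosure _)
    (denseRange_toMinTensor _ x)

lemma exists_countable_mem_tensorSpan {x : minTensor (reducedCrossedProduct α)}
    (hx : x ∈ tensorSpan α Set.univ) : ∃ T : Set G, T.Countable ∧ x ∈ tensorSpan α T := by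
  refine Submodule.span_induction ?_ ?_ ?_ ?_ hx
  · rintro _ ⟨g, -, a, b, rfl⟩
    exact ⟨{g}, Set.countable_singleton g, Submodule.subset_span ⟨g, rfl, a, b, rfl⟩⟩
  · exact ⟨∅, Set.countable_empty, Submodule.zero_mem _⟩
  · rintro x y _ _ ⟨S, hS, hx⟩ ⟨T, hT, hy⟩
    exact ⟨S ∪ T, hS.union hT, Submodule.add_mem _
      (tensorSpan_mono α Set.subset_union_left hx) (tensorSpan_mono α Set.subset_union_right hy)⟩
  · rintro z x _ ⟨T, hT, hx⟩
    exact ⟨T, hT, Submodule.smul_mem _ z hx⟩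

/-- Every element of `(A ⋊ G) ⊗ B(ℓ²)` is supported on a countable subset of `G`. -/
lemma exists_countable_mem_closure_tensorSpan (x : minTensor (reducedCrossedProduct α)) :
    ∃ T : Set G, T.Countable ∧
      x ∈ closure (tensorSpan α T : Set (minTensor (reducedCrossedProduct α))) := by
  obtain ⟨y, hy, hyx⟩ := mem_closure_iff_seq_limit.1 (dense_tensorSpan α x)
  choose T hT hyT using fun n => exists_countable_mem_tensorSpan α (hy n)
  exact ⟨⋃ n, T n, Set.countable_iUnion hT, mem_closure_of_tendsto hyx
    (Filter.Eventually.of_forall fun n => tensorSpan_mono α (Set.subset_iUnion T n) (hyT n))⟩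

lemma inner_elem_opTensor_fiberIncl (g s t : G) (a : A) (b : ell2 →L[ℂ] ell2) (ξ η : H)
    (v w : ell2) :
    inner ℂ (elem s η w) (opTensor (fiberIncl α g a : lp (fun _ : G => H) 2 →L[ℂ] _) b
      (elem t ξ v)) =
    (if s = g * t then inner ℂ η (((α (g * t)⁻¹ a : A) : H →L[ℂ] H) ξ) else 0) *
      inner ℂ w (b v) := by
  rw [opTensor_elem, coe_fiberIncl, piRep_mul_lam_single, ← elem, inner_elem]

section

variable {Γ : Subgroup G} {W : Γ → ell2 →ₗᵢ[ℂ] ell2}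
  (hW : OrthogonalFamily ℂ (fun _ : Γ => ell2) W) (q : G → Γ)

/-- The map `π(a) λ_g ⊗ b ↦ π(a) λ_g ⊗ (λ_g ⊗ b)`, on all of `B(ℓ²(G, H) ⊗ ℓ²)`. -/
def absorb (H : Type*) [NormedAddCommGroup H] [InnerProductSpace ℂ H] [CompleteSpace H] :
    (HilbertTensor (lp (fun _ : G => H) 2) →L[ℂ] HilbertTensor (lp (fun _ : G => H) 2)) →L[ℂ]
      (HilbertTensor (lp (fun _ : G => H) 2) →L[ℂ] HilbertTensor (lp (fun _ : G => H) 2)) :=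
  conjSum _ (IsColumnContraction.diagTensor (H := H)
    fun t : G => isColumnContraction_adjoint hW (q t))

lemma absorb_opTensor_fiberIncl (hq : ∀ (g : Γ) (t : G), q (g * t) = g * q t) (g : Γ) (a : A)
    (b : ell2 →L[ℂ] ell2) :
    absorb hW q H (opTensor (fiberIncl α (g : G) a : lp (fun _ : G => H) 2 →L[ℂ] _) b) =
      opTensor (fiberIncl α (g : G) a : lp (fun _ : G => H) 2 →L[ℂ] _) (shift hW g b) := by
  refine elem_ext_inner fun t ξ v s η w => ?_
  rw [absorb, inner_conjSum]
  simp only [diagTensor_elem, inner_elem_opTensor_fiberIncl]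
  rw [tsum_mul_left]
  by_cases hs : s = g * t
  · congr 1
    rw [inner_shift, hs, hq]
    refine (tsum_congr fun r => ?_).trans ((Equiv.mulLeft (q t)).tsum_eq fun r =>
      inner ℂ ((W (g * r)).toContinuousLinearMap.adjoint w)
        (b ((W r).toContinuousLinearMap.adjoint v)))
    rw [Equiv.coe_mulLeft, mul_assoc]
  · rw [if_neg hs, zero_mul, zero_mul]

lemma isColumnContraction_ite (p : G) (S : ell2 →ₗᵢ[ℂ] ell2) :
    IsColumnContraction fun j : G => if p = j then S.toContinuousLinearMap else 0 := by
  intro s v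
  have h : ∀ j, ‖(if p = j then S.toContinuousLinearMap else 0) v‖ ^ 2 =
      if p = j then ‖v‖ ^ 2 else 0 := fun j => by
    split_ifs <;> simp
  simp only [h, Finset.sum_ite_eq]
  split_ifs
  · exact le_rfl
  · positivity

/-- A left inverse of `absorb` that takes `π(a) λ_h ⊗ (λ_g ⊗ b)` to `0` for `h ≠ g`. -/
def unabsorb (W : Γ → ell2 →ₗᵢ[ℂ] ell2) (q : G → Γ) (H : Type*) [NormedAddCommGroup H]
    [InnerProductSpace ℂ H] [CompleteSpace H] :
    (HilbertTensor (lp (fun _ : G => H) 2) →L[ℂ] HilbertTensor (lp (fun _ : G => H) 2)) →L[ℂ]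
      (HilbertTensor (lp (fun _ : G => H) 2) →L[ℂ] HilbertTensor (lp (fun _ : G => H) 2)) :=
  conjSum _ (IsColumnContraction.diagTensor (H := H)
    fun t : G => isColumnContraction_ite ((q t : G)⁻¹ * t) (W (q t)))

lemma tsum_inner_ite_shift (hq : ∀ (g : Γ) (t : G), q (g * t) = g * q t) (g : Γ) (s t : G)
    (b : ell2 →L[ℂ] ell2) (v w : ell2) :
    ∑' j : G, inner ℂ ((if (q s : G)⁻¹ * s = j then (W (q s)).toContinuousLinearMap else 0) w)
      (shift hW g b ((if (q t : G)⁻¹ * t = j then (W (q t)).toContinuousLinearMap else 0) v)) =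
      if s = g * t then inner ℂ w (b v) else 0 := by
  rw [tsum_eq_single ((q t : G)⁻¹ * t) fun j hj => by
      rw [if_neg hj.symm, zero_apply, map_zero, inner_zero_right], if_pos rfl,
    LinearIsometry.coe_toContinuousLinearMap, shift_apply]
  by_cases hs : s = g * t
  · have hqs : q s = g * q t := by rw [hs, hq]
    have hp : (q s : G)⁻¹ * s = (q t : G)⁻¹ * t := by
      rw [hqs, hs, Subgroup.coe_mul]
      group
    rw [if_pos hp, if_pos hs, LinearIsometry.coe_toContinuousLinearMap, hqs,
      LinearIsometry.inner_map_map]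
  · rw [if_neg hs]
    by_cases hp : (q s : G)⁻¹ * s = (q t : G)⁻¹ * t
    · rw [if_pos hp, LinearIsometry.coe_toContinuousLinearMap]
      refine hW (fun hqs => hs ?_) w (b v)
      rw [hqs, inv_mul_eq_iff_eq_mul, Subgroup.coe_mul] at hp
      rw [hp]
      group
    · rw [if_neg hp, zero_apply, inner_zero_left]

lemma unabsorb_opTensor_fiberIncl (hq : ∀ (g : Γ) (t : G), q (g * t) = g * q t) (g : Γ) (h : G)
    (a : A) (b : ell2 →L[ℂ] ell2) :
    unabsorb W q H (opTensor (fiberIncl α h a : lp (fun _ : G => H) 2 →L[ℂ] _) (shift hW g b)) =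
      opTensor (fiberIncl α (g : G) (coeff α g (fiberIncl α h a)) :
        lp (fun _ : G => H) 2 →L[ℂ] _) b := by
  refine elem_ext_inner fun t ξ v s η w => ?_
  rw [unabsorb, inner_conjSum]
  simp only [diagTensor_elem, inner_elem_opTensor_fiberIncl]
  rw [tsum_mul_left, tsum_inner_ite_shift hW q hq, coeff_fiberIncl]
  by_cases hs : s = g * t
  · rw [if_pos hs, if_pos hs]
    congr 1
    by_cases hg : h = g
    · rw [if_pos (by rw [hg, hs]), if_pos hg, hg]
    · rw [if_neg (by rw [hs, mul_left_inj]; exact fun h' => hg h'.symm), if_neg hg, map_zero,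
        ZeroMemClass.coe_zero, zero_apply, inner_zero_right]
  · rw [if_neg hs, if_neg hs, mul_zero, zero_mul]

/-- The absorption of the coaction of a countable subgroup in `B(ℓ²)`. -/
lemma exists_absorption (Γ : Subgroup G) [Countable Γ] :
    ∃ Θ Ψ : (HilbertTensor (lp (fun _ : G => H) 2) →L[ℂ] HilbertTensor (lp (fun _ : G => H) 2))
        →L[ℂ] (HilbertTensor (lp (fun _ : G => H) 2) →L[ℂ] HilbertTensor (lp (fun _ : G => H) 2)),
      ‖Ψ‖ ≤ 1 ∧ ∀ g ∈ Γ, ∀ b : ell2 →L[ℂ] ell2, ∃ b' : ell2 →L[ℂ] ell2,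
        (∀ a, Θ (opTensor (fiberIncl α g a : lp (fun _ : G => H) 2 →L[ℂ] _) b) =
          opTensor (fiberIncl α g a : lp (fun _ : G => H) 2 →L[ℂ] _) b') ∧
        ∀ d : reducedCrossedProduct α, Ψ (opTensor (d : lp (fun _ : G => H) 2 →L[ℂ] _) b') =
          opTensor (fiberIncl α g (coeff α g d) : lp (fun _ : G => H) 2 →L[ℂ] _) b := by
  obtain ⟨W, hW⟩ := exists_orthogonalFamily_ell2 Γ
  obtain ⟨q, hq⟩ := exists_equivariant_retraction Γ
  refine ⟨absorb hW q H, unabsorb W q H, norm_conjSum_le _ _, fun g hg b =>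
    ⟨shift hW ⟨g, hg⟩ b, fun a => absorb_opTensor_fiberIncl α hW q hq ⟨g, hg⟩ a b, fun d => ?_⟩⟩
  have h : unabsorb W q H ∘L opTensorLeft _ (shift hW ⟨g, hg⟩ b) ∘L inclOp _ =
      opTensorLeft (lp (fun _ : G => H) 2) b ∘L inclOp _ ∘L fiberIncl α g ∘L coeff α g :=
    fiberIncl_ext α fun h a => unabsorb_opTensor_fiberIncl α hW q hq ⟨g, hg⟩ h a b
  exact congrArg (fun f => f d) h

end

end Absorption

section Transfer

section Abstract

variable {E B : Type*} [NormedAddCommGroup E] [NormedSpace ℂ E] [NormedAddCommGroup B]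
  [NormedSpace ℂ B]

/-- `z ∈ E` represents `Θ x`, and `Q x` can be recovered from `P z` through `Ψ` for all
`(P, Q) ∈ R`. -/
structure Represents (ι : E →ₗᵢ[ℂ] B) (Θ Ψ : B →L[ℂ] B) (R : Set ((E →L[ℂ] E) × (E →L[ℂ] E)))
    (x z : E) : Prop where
  absorb : Θ (ι x) = ι z
  unabsorb : Ψ (ι z) = ι x
  map : ∀ p ∈ R, Ψ (ι (p.1 z)) = ι (p.2 x)

variable {ι : E →ₗᵢ[ℂ] B} {Θ Ψ : B →L[ℂ] B} {R : Set ((E →L[ℂ] E) × (E →L[ℂ] E))}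

lemma Represents.of_tendsto (hι : IsClosed (Set.range ι)) {x z : ℕ → E} {y : E}
    (h : ∀ n, Represents ι Θ Ψ R (x n) (z n)) (hx : Tendsto x atTop (𝓝 y)) :
    ∃ w, Represents ι Θ Ψ R y w := by
  have hx' : Tendsto (fun n => ι (x n)) atTop (𝓝 (ι y)) := (ι.continuous.tendsto y).comp hx
  have hz : Tendsto (fun n => ι (z n)) atTop (𝓝 (Θ (ι y))) :=
    ((Θ.continuous.tendsto _).comp hx').congr fun n => (h n).absorb
  obtain ⟨w, hw⟩ := hι.mem_of_tendsto hz (Filter.Eventually.of_forall fun n => ⟨z n, rfl⟩)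
  rw [← hw] at hz
  have hz' : Tendsto z atTop (𝓝 w) := ι.isometry.isEmbedding.tendsto_nhds_iff.2 hz
  refine ⟨w, hw.symm, ?_, fun p hp => ?_⟩
  · exact tendsto_nhds_unique (((Ψ.continuous.tendsto _).comp hz).congr fun n => (h n).unabsorb) hx'
  · have hc : Continuous fun z => Ψ (ι (p.1 z)) := by fun_prop
    have hc' : Continuous fun x => ι (p.2 x) := by fun_prop
    exact tendsto_nhds_unique
      (((hc.tendsto w).comp hz').congr fun n => (h n).map p hp) ((hc'.tendsto y).comp hx)

lemma exists_represents_of_mem_span {s : Set E} (h : ∀ x ∈ s, ∃ z, Represents ι Θ Ψ R x z) {x : E}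
    (hx : x ∈ Submodule.span ℂ s) : ∃ z, Represents ι Θ Ψ R x z := by
  refine Submodule.span_induction ?_ ?_ ?_ ?_ hx
  · exact h
  · exact ⟨0, by simp, by simp, by simp⟩
  · rintro x y _ _ ⟨z, hz⟩ ⟨w, hw⟩
    refine ⟨z + w, ?_, ?_, fun p hp => ?_⟩
    · simp only [map_add, hz.absorb, hw.absorb]
    · simp only [map_add, hz.unabsorb, hw.unabsorb]
    · simp only [map_add, hz.map p hp, hw.map p hp]
  · rintro a x _ ⟨z, hz⟩
    refine ⟨a • z, ?_, ?_, fun p hp => ?_⟩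
    · simp only [map_smul, hz.absorb]
    · simp only [map_smul, hz.unabsorb]
    · simp only [map_smul, hz.map p hp]

lemma Represents.dist_le {x z : E} (h : Represents ι Θ Ψ R x z) (hΨ : ‖Ψ‖ ≤ 1)
    {p : (E →L[ℂ] E) × (E →L[ℂ] E)} (hp : p ∈ R) : dist (p.2 x) x ≤ dist (p.1 z) z := by
  rw [← ι.dist_map, ← ι.dist_map (p.1 z), ← h.map p hp]
  conv_lhs => rw [← h.unabsorb]
  rw [dist_eq_norm, dist_eq_norm, ← map_sub]
  exact (Ψ.le_of_opNorm_le hΨ _).trans_eq (one_mul _)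

lemma exists_dist_le_of_represents (hι : IsClosed (Set.range ι)) (hΨ : ‖Ψ‖ ≤ 1) {s : Set E}
    (h : ∀ x ∈ s, ∃ z, Represents ι Θ Ψ R x z) {x : E}
    (hx : x ∈ closure (Submodule.span ℂ s : Set E)) :
    ∃ z, ∀ p ∈ R, dist (p.2 x) x ≤ dist (p.1 z) z := by
  obtain ⟨y, hy, hyx⟩ := mem_closure_iff_seq_limit.1 hx
  choose z hz using fun n => exists_represents_of_mem_span h (hy n)
  obtain ⟨w, hw⟩ := Represents.of_tendsto hι hz hyx
  exact ⟨w, fun p hp => hw.dist_le hΨ hp⟩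


end Abstract

section Concrete

variable {K : Type*} [NormedAddCommGroup K] [InnerProductSpace ℂ K] [CompleteSpace K]
  {C : StarSubalgebra ℂ (K →L[ℂ] K)} {G M : Type*}

/-- `S` is the map on the fibers `ι g` obtained from `Φ` by taking coefficients `π g`. -/
def IsDiagonalPart (ι : G → M → C) (π : G → C → M) (Φ S : CBMap C) : Prop :=
  ∀ g a, (S : C →L[ℂ] C) (ι g a) = ι g (π g ((Φ : C →L[ℂ] C) (ι g a)))

/-- The amplifications of the pairs `(Φ, S)` with `S` the diagonal part of `Φ`. -/
def diagonalPairs (ι : G → M → C) (π : G → C → M) :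
    Set ((minTensor C →L[ℂ] minTensor C) × (minTensor C →L[ℂ] minTensor C)) :=
  {p | ∃ Φ S : CBMap C, IsDiagonalPart ι π Φ S ∧
    p = (amplify (Φ : C →L[ℂ] C), amplify (S : C →L[ℂ] C))}

/-- Approximation of any `x ∈ C ⊗ B(ℓ²)` by diagonal parts of maps is controlled by approximation of
a single element by the maps themselves. -/
def ControlsDiagonalParts (ι : G → M → C) (π : G → C → M) : Prop :=
  ∀ x : minTensor C, ∃ z : minTensor C, ∀ Φ S : CBMap C, IsDiagonalPart ι π Φ S →
    dist (amplify (S : C →L[ℂ] C) x) x ≤ dist (amplify (Φ : C →L[ℂ] C) z) z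

lemma amplify_tmul (T : CBMap C) (c : C) (b : ell2 →L[ℂ] ell2) :
    amplify (T : C →L[ℂ] C) (toMinTensor C (c ⊗ₜ b)) =
      toMinTensor C ((T : C →L[ℂ] C) c ⊗ₜ b) :=
  amplify_toMinTensor T _

lemma Represents.of_tmul
    {Θ Ψ : (HilbertTensor K →L[ℂ] HilbertTensor K) →L[ℂ] (HilbertTensor K →L[ℂ] HilbertTensor K)}
    {R : Set ((minTensor C →L[ℂ] minTensor C) × (minTensor C →L[ℂ] minTensor C))}
    {c : C} {b b' : ell2 →L[ℂ] ell2}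
    (hΘ : Θ (opTensor (c : K →L[ℂ] K) b) = opTensor (c : K →L[ℂ] K) b')
    (hΨ : Ψ (opTensor (c : K →L[ℂ] K) b') = opTensor (c : K →L[ℂ] K) b)
    (hR : ∀ p ∈ R, ∃ d d' : C, p.1 (toMinTensor C (c ⊗ₜ b')) = toMinTensor C (d ⊗ₜ b') ∧
      p.2 (toMinTensor C (c ⊗ₜ b)) = toMinTensor C (d' ⊗ₜ b) ∧
      Ψ (opTensor (d : K →L[ℂ] K) b') = opTensor (d' : K →L[ℂ] K) b) :
    Represents (minTensor C).subtypeₗᵢ Θ Ψ R (toMinTensor C (c ⊗ₜ b))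
      (toMinTensor C (c ⊗ₜ b')) where
  absorb := hΘ
  unabsorb := hΨ
  map p hp := by
    obtain ⟨d, d', h1, h2, h⟩ := hR p hp
    rw [h1, h2]
    exact h

lemma isClosed_range_subtypeIsometry_minTensor :
    IsClosed (Set.range (minTensor C).subtypeₗᵢ) := by
  rw [Submodule.coe_subtypeₗᵢ, Submodule.coe_subtype, Subtype.range_coe]
  exact Submodule.isClosed_topologicalClosure _

/-- The maps `Θ` and `Ψ` trade `b` for some `b'` on the fibers over `Γ`, and `Ψ` takes
coefficients in doing so. -/
def HasAbsorption (ι : G → M → C) (π : G → C → M) (Γ : Set G) : Prop :=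
  ∃ Θ Ψ : (HilbertTensor K →L[ℂ] HilbertTensor K) →L[ℂ] (HilbertTensor K →L[ℂ] HilbertTensor K),
    ‖Ψ‖ ≤ 1 ∧ ∀ g ∈ Γ, ∀ b : ell2 →L[ℂ] ell2, ∃ b' : ell2 →L[ℂ] ell2,
      (∀ a, Θ (opTensor (ι g a : K →L[ℂ] K) b) = opTensor (ι g a : K →L[ℂ] K) b') ∧
      ∀ d : C, Ψ (opTensor (d : K →L[ℂ] K) b') = opTensor (ι g (π g d) : K →L[ℂ] K) b

lemma controlsDiagonalParts_of_hasAbsorption {ι : G → M → C} {π : G → C → M}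
    (hπ : ∀ g a, π g (ι g a) = a)
    (hx : ∀ x : minTensor C, ∃ Γ : Set G, x ∈ closure (Submodule.span ℂ {x | ∃ g ∈ Γ, ∃ a b,
      x = toMinTensor C (ι g a ⊗ₜ b)} : Set (minTensor C)) ∧ HasAbsorption ι π Γ) :
    ControlsDiagonalParts ι π := by
  intro x
  obtain ⟨Γ, hx, Θ, Ψ, hΨ, h⟩ := hx x
  suffices h' : ∃ z : minTensor C, ∀ p ∈ diagonalPairs ι π, dist (p.2 x) x ≤ dist (p.1 z) z by
    obtain ⟨z, hz⟩ := h'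
    exact ⟨z, fun Φ S hS => hz (amplify (Φ : C →L[ℂ] C), amplify (S : C →L[ℂ] C)) ⟨Φ, S, hS, rfl⟩⟩
  refine exists_dist_le_of_represents isClosed_range_subtypeIsometry_minTensor (Θ := Θ) hΨ ?_ hx
  rintro _ ⟨g, hg, a, b, rfl⟩
  obtain ⟨b', hΘ, hb'⟩ := h g hg b
  refine ⟨_, Represents.of_tmul (hΘ a) ((hb' _).trans (by rw [hπ])) ?_⟩
  rintro _ ⟨Φ, S, hS, rfl⟩
  exact ⟨_, _, amplify_tmul Φ _ _, amplify_tmul S _ _, (hb' _).trans (by rw [hS g a])⟩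

end Concrete

variable {G : Type*} [Group G] [DecidableEq G] {H : Type*} [NormedAddCommGroup H]
  [InnerProductSpace ℂ H] [CompleteSpace H] {A : StarSubalgebra ℂ (H →L[ℂ] H)}
  [IsClosed (A : Set (H →L[ℂ] H))] (α : G →* (A ≃⋆ₐ[ℂ] A))

lemma controlsDiagonalParts_coeff :
    ControlsDiagonalParts (C := reducedCrossedProduct α) (fun g => fiberIncl α g)
      (fun g => coeff α g) := by
  refine controlsDiagonalParts_of_hasAbsorption (fun g a => ?_) fun x => ?_
  · rw [coeff_fiberIncl, if_pos rfl]
  · obtain ⟨T, hT, hx⟩ := exists_countable_mem_closure_tensorSpan α x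
    have : Countable (Subgroup.closure T) := countable_subgroup_closure hT
    exact ⟨Subgroup.closure T, closure_mono (tensorSpan_mono α Subgroup.subset_closure) hx,
      exists_absorption α (Subgroup.closure T)⟩

end Transfer

theorem hasSOAP_of_hasAP {H : Type u} [NormedAddCommGroup H] [InnerProductSpace ℂ H]
    [CompleteSpace H] {G : Type v} [Group G] {A : StarSubalgebra ℂ (H →L[ℂ] H)}
    [IsClosed (A : Set (H →L[ℂ] H))] {α : G →* (A ≃⋆ₐ[ℂ] A)} (h : HasAP α) :
    HasSOAP (reducedCrossedProduct α) := by
  classical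
  obtain ⟨ι, _, _, _, F, hs, hr, hF⟩ := h
  obtain ⟨S, hS, hSx⟩ := exists_net
    (fun (S : CBMap (reducedCrossedProduct α)) (x : minTensor (reducedCrossedProduct α)) =>
      amplify (S : reducedCrossedProduct α →L[ℂ] reducedCrossedProduct α) x)
    (· ∈ finiteRankCB (reducedCrossedProduct α)) fun X ε hε =>
      exists_finiteRankCB_dist_lt (fun i => (F i).toCBMap)
        (fun i => (F i).toCBMap_mem_finiteRankCB (hs i) (hr i))
        (fun x ψ => hF _ ⟨x, ψ, rfl⟩) X ε hε
  exact ⟨Finset (minTensor (reducedCrossedProduct α)) × ℕ, inferInstance, inferInstance,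
    inferInstance, fun i => (S i : reducedCrossedProduct α →L[ℂ] reducedCrossedProduct α), hS, hSx⟩

section

variable {K : Type u} [NormedAddCommGroup K] [InnerProductSpace ℂ K] [CompleteSpace K]
  {C : StarSubalgebra ℂ (K →L[ℂ] K)}

/-- If `C` has the SOAP, the identity is approximated on finite sets by finite rank maps with range
in a given dense subspace. -/
lemma HasSOAP.exists_sum_smulRight (h : HasSOAP C) {D : Submodule ℂ C} (hD : Dense (D : Set C))
    (Z : Finset (minTensor C)) {ε : ℝ} (hε : 0 < ε) :
    ∃ (n : ℕ) (φ : Fin n → C →L[ℂ] ℂ) (d : Fin n → C), (∀ k, d k ∈ D) ∧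
      ∀ z ∈ Z, dist (amplify (∑ k, (φ k).smulRight (d k)) z) z < ε := by
  obtain ⟨ι, _, _, _, Φ, hΦ, hconv⟩ := h
  obtain ⟨i, hi⟩ := ((Finset.eventually_all Z).2 fun z _ =>
    Metric.tendsto_nhds.1 (hconv z) (ε / 2) (half_pos hε)).exists
  obtain ⟨n, φ, c, hc⟩ := exists_eq_sum_smulRight (Φ i) (hΦ i)
  have hsum : Φ i = ∑ k, (φ k).smulRight (c k) := by
    ext x : 1
    rw [hc, sum_apply]
    rfl
  set M := (∑ k, ‖φ k‖) * ∑ z ∈ Z, ‖z‖ with hM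
  have hM0 : 0 ≤ M := by positivity
  have hδ : 0 < ε / 2 / (M + 1) := by positivity
  choose d hdD hd using fun k => Metric.mem_closure_iff.1 (hD (c k)) _ hδ
  refine ⟨n, φ, d, hdD, fun z hz => ?_⟩
  have h1 := norm_amplify_sum_smulRight_sub_le φ c d z
  have h2 : (∑ k, ‖φ k‖ * ‖c k - d k‖) * ‖z‖ < ε / 2 := by
    calc _ ≤ (∑ k, ‖φ k‖ * (ε / 2 / (M + 1))) * ∑ z ∈ Z, ‖z‖ := by
          gcongr with k
          · rw [← dist_eq_norm]
            exact (hd k).le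
          · exact Finset.single_le_sum (f := fun z : minTensor C => ‖z‖)
              (fun _ _ => norm_nonneg _) hz
      _ = ε / 2 * (M / (M + 1)) := by
          rw [← Finset.sum_mul, hM]
          ring
      _ < ε / 2 * 1 := by
          gcongr
          rw [div_lt_one (by positivity)]
          exact lt_add_one M
      _ = _ := mul_one _
  rw [← dist_eq_norm, dist_comm] at h1
  have h3 := hi z hz
  rw [hsum] at h3
  calc _ ≤ _ := dist_triangle _ _ _
    _ < ε / 2 + ε / 2 := add_lt_add (h1.trans_lt h2) h3
    _ = ε := add_halves ε

/-- The diagonal parts of the finite rank maps with range in `D` are among the maps `S b` for which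
`P b` holds. -/
def HasDiagonalParts {G M β : Type*} (ι : G → M → C) (π : G → C → M) (D : Submodule ℂ C)
    (S : β → CBMap C) (P : β → Prop) : Prop :=
  ∀ (n : ℕ) (φ : Fin n → C →L[ℂ] ℂ) (d : Fin n → C), (∀ k, d k ∈ D) →
    ∃ b, P b ∧ ∀ Φ : CBMap C, (Φ : C →L[ℂ] C) = ∑ k, (φ k).smulRight (d k) →
      IsDiagonalPart ι π Φ (S b)

lemma tendsto_omega_id {ι : Type*} {l : Filter ι} {S : ι → CBMap C} {x : minTensor C}
    (h : Tendsto (fun i => amplify (S i : C →L[ℂ] C) x) l (𝓝 x)) (ψ : minTensor C →L[ℂ] ℂ) :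
    Tendsto (fun i => omega x ψ (S i)) l (𝓝 (omega x ψ (CBMap.id C))) := by
  have hid : omega x ψ (CBMap.id C) = ψ x := by
    change ψ (amplify (ContinuousLinearMap.id ℂ C) x) = ψ x
    rw [amplify_id]
    rfl
  rw [hid]
  exact (ψ.continuous.tendsto x).comp h

/-- If `C` has the SOAP, the identity is approximated by the diagonal parts of finite rank maps. -/
lemma HasSOAP.exists_tendsto_omega {G M β : Type*} (h : HasSOAP C) {ι : G → M → C}
    {π : G → C → M} {D : Submodule ℂ C} (hD : Dense (D : Set C)) {S : β → CBMap C}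
    {P : β → Prop} (hc : ControlsDiagonalParts ι π) (hS : HasDiagonalParts ι π D S P) :
    ∃ b : Finset (minTensor C) × ℕ → β, (∀ i, P (b i)) ∧ ∀ x (ψ : minTensor C →L[ℂ] ℂ),
      Tendsto (fun i => omega x ψ (S (b i))) atTop (𝓝 (omega x ψ (CBMap.id C))) := by
  classical
  choose z hz using hc
  obtain ⟨b, hb, hbS⟩ := exists_net
    (fun b (x : minTensor C) => amplify (S b : C →L[ℂ] C) x) P fun X ε hε => by
      obtain ⟨n, φ, d, hd, hdz⟩ := h.exists_sum_smulRight hD (X.image z) hε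
      obtain ⟨b, hb, hbS⟩ := hS n φ d hd
      have hcb : ∑ k, (φ k).smulRight (d k) ∈ CBMap C :=
        ⟨_, CBBound.sum Finset.univ fun k _ => CBBound.smulRight (φ k) (d k)⟩
      exact ⟨b, hb, fun x hx => (hz x ⟨_, hcb⟩ (S b) (hbS _ rfl)).trans_lt
        (hdz _ (Finset.mem_image_of_mem z hx))⟩
  exact ⟨b, hb, fun x ψ => tendsto_omega_id (hbS x) ψ⟩

end

variable {H : Type u} [NormedAddCommGroup H] [InnerProductSpace ℂ H]
  [CompleteSpace H] {G : Type v} [Group G] {A : StarSubalgebra ℂ (H →L[ℂ] H)}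
  [IsClosed (A : Set (H →L[ℂ] H))]

lemma isDiagonalPart_toCBMap [DecidableEq G] {α : G →* (A ≃⋆ₐ[ℂ] A)} {F : HerzSchurMultiplier α}
    {Φ : CBMap (reducedCrossedProduct α)}
    (h : ∀ g a, (F.1 g : A →L[ℂ] A) a = coeff α g
      ((Φ : reducedCrossedProduct α →L[ℂ] reducedCrossedProduct α) (fiberIncl α g a))) :
    IsDiagonalPart (C := reducedCrossedProduct α) (fun g => fiberIncl α g) (fun g => coeff α g) Φ
      F.toCBMap := fun g a =>
  (F.isMultiplierMap_toCBMap.apply_fiberIncl g a).trans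
    (congrArg (fun a => fiberIncl α g a) (h g a))

lemma hasDiagonalParts_toCBMap [DecidableEq G] (α : G →* (A ≃⋆ₐ[ℂ] A)) :
    HasDiagonalParts (C := reducedCrossedProduct α) (fun g => fiberIncl α g)
      (fun g => coeff α g) (fiberSpan α) (fun F : HerzSchurMultiplier α => F.toCBMap)
      fun F => {r : G | F.1 r ≠ 0}.Finite ∧
        ∀ r, FiniteDimensional ℂ (LinearMap.range (F.1 r : A →L[ℂ] A).toLinearMap) := by
  intro n φ d hd
  obtain ⟨F, hfin, hrank, hFval⟩ := exists_herzSchurMultiplier φ d hd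
  exact ⟨F, ⟨hfin, hrank⟩, fun Φ hΦ => isDiagonalPart_toCBMap fun g a => (hFval g a).trans
    (congrArg (fun T : reducedCrossedProduct α →L[ℂ] reducedCrossedProduct α =>
      coeff α g (T (fiberIncl α g a))) hΦ.symm)⟩

theorem hasAP_of_hasSOAP {α : G →* (A ≃⋆ₐ[ℂ] A)} (h : HasSOAP (reducedCrossedProduct α)) :
    HasAP α := by
  classical
  obtain ⟨F, hF, hFx⟩ := h.exists_tendsto_omega (dense_fiberSpan α)
    (controlsDiagonalParts_coeff α) (hasDiagonalParts_toCBMap α)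
  refine ⟨Finset (minTensor (reducedCrossedProduct α)) × ℕ, inferInstance, inferInstance,
    inferInstance, F, fun i => (hF i).1, fun i => (hF i).2, ?_⟩
  rintro _ ⟨x, ψ, rfl⟩
  exact hFx x ψ

end CrossedProductAP

end

theorem theorem4p4 {H : Type*} [NormedAddCommGroup H] [InnerProductSpace ℂ H] [CompleteSpace H]
    {G : Type*} [Group G] (A : StarSubalgebra ℂ (H →L[ℂ] H)) [IsClosed (A : Set (H →L[ℂ] H))]
    (α : G →* (A ≃⋆ₐ[ℂ] A)) :
    CrossedProductAP.HasAP α ↔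
      CrossedProductAP.HasSOAP (CrossedProductAP.reducedCrossedProduct α) :=
  ⟨CrossedProductAP.hasSOAP_of_hasAP, CrossedProductAP.hasAP_of_hasSOAP⟩
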